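/- For a finite set $\mathcal D$ and probability distributions $P,Q$ on $\mathcal D$ let $D_H^2(P,Q)=\frac12\sum_{x\in\mathcal D}\bigl(\sqrt{P(x)}-\sqrt{Q(x)}\bigr)^2$ be the squared Hellinger distance. Let $A,C$ be finite alphabets of sizes $d_A\ge d_C\ge 1$ and let $\varepsilon>0$. A (possibly randomized) tester receives $N$ i.i.d. samples from each of two unknown distributions $P_{AC}$ and $Q_{AC}$ on $A\times C$ (all samples independent), where $Q_{AC}=Q_AQ_C$ is promised to be a product distribution, and outputs "Yes" or "No". It succeeds if, for all such $P_{AC}$ and $Q_{AC}$, it outputs "Yes" with probability at least $2/3$ whenever $P_{AC}=Q_AQ_C$, and outputs "No" with probability at least $2/3$ whenever $D_H^2(P_{AC},Q_AQ_C)\ge\varepsilon$. Let $\mathrm{SC}_{\mathrm{EqProd}}(D_H^2,\varepsilon,d_A,d_C)$ be the least $N$ for which a successful tester exists ($\infty$ if there is none). Then $$\mathrm{SC}_{\mathrm{EqProd}}(D_H^2,\varepsilon,d_A,d_C)=\widetilde O\left(\min\left\{\frac{d_A^{3/4}d_C^{1/4}}{\varepsilon},\ \frac{d_A^{2/3}d_C^{1/3}}{\varepsilon^{4/3}}\right\}\right),$$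 that is, there are universal constants $K>0$ and $k\in\mathbb N$ such that for all integers $d_A\ge d_C\ge1$ and all $\varepsilon>0$ $$\mathrm{SC}_{\mathrm{EqProd}}(D_H^2,\varepsilon,d_A,d_C)\le K\,\log^k\!\left(2+\frac{d_Ad_C}{\varepsilon}\right)\min\left\{\frac{d_A^{3/4}d_C^{1/4}}{\varepsilon},\ \frac{d_A^{2/3}d_C^{1/3}}{\varepsilon^{4/3}}\right\}.$$ -/

import Mathlib

open MeasureTheory
open scoped ENNReal

noncomputable section

namespace EqProd

/-- The squared Hellinger distance `½ ∑ₓ (√P(x) - √Q(x))²` of two distributions on a finite set. -/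
def hellingerSq {Ω : Type} [Fintype Ω] (P Q : PMF Ω) : ℝ :=
  (1 / 2) * ∑ x, (Real.sqrt (P x).toReal - Real.sqrt (Q x).toReal) ^ 2

/-- `Q` is a product distribution `Q_A Q_C` on `A × C`. -/
def IsProduct {A C : Type} (Q : PMF (A × C)) : Prop :=
  ∃ (QA : PMF A) (QC : PMF C), ∀ a c, Q (a, c) = QA a * QC c

/-- The joint law of `N` independent samples from `P`. -/
def iidLaw {Ω : Type} [MeasurableSpace Ω] (P : PMF Ω) (N : ℕ) : Measure (Fin N → Ω) :=
  Measure.pi fun _ => P.toMeasure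

/-- A (possibly randomized) tester that reads `N` samples from each of two distributions on `Ω`
and outputs `true` ("Yes", equal) or `false` ("No", far). The value is the law of its output
given the samples. -/
abbrev Tester (Ω : Type) (N : ℕ) : Type := (Fin N → Ω) → (Fin N → Ω) → PMF Bool

/-- The probability that the tester `T` outputs `b` when it is given `N` i.i.d. samples from `P`
and, independently, `N` i.i.d. samples from `Q`. -/
def outputProb {Ω : Type} [MeasurableSpace Ω] {N : ℕ} (T : Tester Ω N) (P Q : PMF Ω) (b : Bool) :
    ℝ≥0∞ :=
  ∫⁻ s, T s.1 s.2 b ∂((iidLaw P N).prod (iidLaw Q N))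

/-- `T` solves equivalence testing for product distributions at threshold `ε` with respect to
the distance measure `Δ`, with success probability at least `2/3`. -/
def Succeeds {A C : Type} [MeasurableSpace A] [MeasurableSpace C]
    (Δ : PMF (A × C) → PMF (A × C) → ℝ) (ε : ℝ) {N : ℕ} (T : Tester (A × C) N) : Prop :=
  ∀ P Q : PMF (A × C), IsProduct Q →
    (P = Q → 2 / 3 ≤ outputProb T P Q true) ∧
    (ε ≤ Δ P Q → 2 / 3 ≤ outputProb T P Q false)

/-- The sample complexity of equivalence testing for product distributions on `A × C`: the least
number `N` of samples (from each distribution) for which a successful tester exists;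
it is `⊤` if there is no such `N`. -/
def sampleComplexity {A C : Type} [MeasurableSpace A] [MeasurableSpace C]
    (Δ : PMF (A × C) → PMF (A × C) → ℝ) (ε : ℝ) : ℕ∞ :=
  ⨅ (N : ℕ) (_ : ∃ T : Tester (A × C) N, Succeeds Δ ε T), (N : ℕ∞)

end EqProd

end

/-!
The tester reads three blocks of `n = 2 ^ I` samples. The first block of samples of `Q` gives
auxiliary samples of each coordinate separately; the other two blocks pair every sample of `P` with
one of `Q`. For scales `i, j ≤ I` let `W` be the set of pairs whose coordinates do not occur among
the first `2 ^ i - 1` and `2 ^ j - 1` auxiliary samples, respectively. Given `W`, counting signed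
collisions between the two paired blocks gives an unbiased estimator of
`n ^ 2 * ∑ u ∈ W, (P u - Q u) ^ 2`. A symbol of mass `r` stays unseen by `k` samples with
probability `(1 - r) ^ k`, so `∑ u ∈ W, Q u ^ 2`, which governs the variance, has mean of order
`min (2 ^ i) d_A / 4 ^ i * (min (2 ^ j) d_C / 4 ^ j)`; here the product structure of `Q` enters. The
tester answers "No" when, for some pair of scales, the statistic exceeds `O(I)` standard deviations
of its law under `P = Q`.

If `P` and `Q` are far apart, then by pigeonhole over the `(I + 1) ^ 2` pairs of dyadic levels of
the masses `Q_A a`, `Q_C c`, some pair `(i, j)` of levels carries a `1 / (I + 1) ^ 2` share of the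
Hellinger distance, and little of it is lost to `W` because these symbols are rarely seen at these
scales. It remains to turn Hellinger distance into `ℓ²` distance. If `i, j < I`, the masses involved
are at least of order `2 ^ (-i) * 2 ^ (-j)`, and `(√x - √y) ^ 2 * (x + y) ≤ (x - y) ^ 2`. If one of
the coordinates is at the lightest level `I`, the other one takes few values, and the
Cauchy–Schwarz inequality suffices. Both cases ask that, up to logarithmic factors,
`d_A * √d_C * √(min n d_A) ≤ (n * ε) ^ 2`; bounding the minimum by `d_A` and by `n` gives the two
rates of the theorem.
-/

noncomputable section

namespace EqProd

open ProbabilityTheory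
open scoped Finset

section Probability

variable {S T : Type*} [MeasurableSpace S] [MeasurableSpace T]

lemma measureReal_prod_le_integral {σ : Measure S} {τ : Measure T} [IsFiniteMeasure σ]
    [IsFiniteMeasure τ] {E : Set (S × T)} (hE : MeasurableSet E) {f : S → ℝ}
    (hf : Integrable f σ) (h : ∀ r, τ.real (Prod.mk r ⁻¹' E) ≤ f r) :
    (σ.prod τ).real E ≤ ∫ r, f r ∂σ := by
  calc (σ.prod τ).real E = ∫ r, τ.real (Prod.mk r ⁻¹' E) ∂σ := by
        rw [measureReal_def, Measure.prod_apply hE, ← integral_toReal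
          (measurable_measure_prodMk_left hE).aemeasurable (.of_forall fun _ => measure_lt_top _ _)]
        rfl
    _ ≤ ∫ r, f r ∂σ :=
        integral_mono (Measure.integrable_measure_prodMk_left hE (measure_ne_top _ _)) hf h

lemma measureReal_prod_le_add {σ : Measure S} {τ : Measure T} [IsProbabilityMeasure σ]
    [IsProbabilityMeasure τ] {E : Set (S × T)} (hE : MeasurableSet E) {B : Set S}
    (hB : MeasurableSet B) {δ : ℝ} (hδ : 0 ≤ δ) (h : ∀ r ∉ B, τ.real (Prod.mk r ⁻¹' E) ≤ δ) :
    (σ.prod τ).real E ≤ σ.real B + δ := by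
  have hint : Integrable (B.indicator fun _ => (1 : ℝ)) σ := (integrable_const 1).indicator hB
  calc (σ.prod τ).real E ≤ ∫ r, (B.indicator (fun _ => 1) r + δ) ∂σ := by
        refine measureReal_prod_le_integral hE (hint.add (integrable_const δ)) fun r => ?_
        by_cases hr : r ∈ B
        · rw [Set.indicator_of_mem hr]
          exact measureReal_le_one.trans (by linarith)
        · rw [Set.indicator_of_notMem hr, zero_add]
          exact h r hr
    _ = σ.real B + δ := by
        rw [integral_add hint (integrable_const δ), integral_indicator hB]
        simp

lemma measureReal_ge_le_integral_div {σ : Measure S} {f : S → ℝ} (h0 : 0 ≤ f)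
    (hf : Integrable f σ) {c : ℝ} (hc : 0 < c) : σ.real {s | c ≤ f s} ≤ (∫ s, f s ∂σ) / c := by
  rw [le_div_iff₀' hc]
  exact mul_meas_ge_le_integral_of_nonneg (.of_forall h0) hf c

lemma measureReal_abs_sub_ge_le_variance_div {σ : Measure S} [IsFiniteMeasure σ] {f : S → ℝ}
    (hf : MemLp f 2 σ) {c : ℝ} (hc : 0 < c) :
    σ.real {s | c ≤ |f s - ∫ t, f t ∂σ|} ≤ Var[f; σ] / c ^ 2 :=
  ENNReal.toReal_le_of_le_ofReal (div_nonneg (variance_nonneg f σ) (sq_nonneg c))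
    (meas_ge_le_variance_div_sq hf hc)

section RandomSubset

variable {ι : Type*} {σ : Measure S} [IsFiniteMeasure σ] {R : S → Finset ι}

omit [MeasurableSpace S] in
lemma sum_mem_eq_sum_indicator [Fintype ι] (R : S → Finset ι) (w : ι → ℝ) (s : S) :
    ∑ u ∈ R s, w u = ∑ u, {s | u ∈ R s}.indicator (fun _ => w u) s := by
  classical
  simp [Set.indicator_apply]

lemma integrable_sum_mem [Finite ι] (hR : ∀ u, MeasurableSet {s | u ∈ R s}) (w : ι → ℝ) :
    Integrable (fun s => ∑ u ∈ R s, w u) σ := by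
  cases nonempty_fintype ι
  simp only [sum_mem_eq_sum_indicator R w]
  exact integrable_finsetSum _ fun u _ => (integrable_const _).indicator (hR u)

lemma integral_sum_mem [Fintype ι] (hR : ∀ u, MeasurableSet {s | u ∈ R s}) (w : ι → ℝ) :
    ∫ s, ∑ u ∈ R s, w u ∂σ = ∑ u, w u * σ.real {s | u ∈ R s} := by
  simp only [sum_mem_eq_sum_indicator R w]
  rw [integral_finsetSum _ fun u _ => (integrable_const _).indicator (hR u)]
  simp only [integral_indicator_const _ (hR _), smul_eq_mul, mul_comm]

end RandomSubset

variable {Ω : Type*} [Finite Ω] [MeasurableSpace Ω] [MeasurableSingletonClass Ω] (P : Measure Ω)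

lemma integral_indicator_eq_sum [IsFiniteMeasure P] (W : Finset Ω) (v : Ω → ℝ) :
    ∫ x, (W : Set Ω).indicator v x ∂P = ∑ u ∈ W, P.real {u} * v u := by
  rw [integral_indicator W.measurableSet, setIntegral_finset W Integrable.of_finite.integrableOn]
  simp

lemma variance_indicator_le [IsProbabilityMeasure P] (W : Finset Ω) (v : Ω → ℝ) :
    Var[(W : Set Ω).indicator v; P] ≤ ∑ u ∈ W, P.real {u} * v u ^ 2 := by
  calc Var[(W : Set Ω).indicator v; P] ≤ ∫ x, (W : Set Ω).indicator v x ^ 2 ∂P :=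
        variance_le_expectation_sq .of_discrete
    _ = ∫ x, (W : Set Ω).indicator (fun u => v u ^ 2) x ∂P := by
        classical simp only [Set.indicator_apply, ite_pow, ne_eq, OfNat.ofNat_ne_zero,
          not_false_eq_true, zero_pow]
    _ = ∑ u ∈ W, P.real {u} * v u ^ 2 := integral_indicator_eq_sum P W _

end Probability

section PairedSamples

variable {Ω : Type*} [DecidableEq Ω]

/-- The number of first components minus the number of second components equal to `u` in the
sequence `s` of paired samples. -/
def countDiff {n : ℕ} (s : Fin n → Ω × Ω) (u : Ω) : ℝ :=
  ∑ i, ((if (s i).1 = u then 1 else 0) - (if (s i).2 = u then 1 else 0))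

/-- The collision statistic on the symbols of `W`: an unbiased estimator (up to normalisation) of
`∑ u ∈ W, (P u - Q u) ^ 2` from two independent blocks of samples from `P × Q`. -/
def collisionStat (W : Finset Ω) {n : ℕ} (s t : Fin n → Ω × Ω) : ℝ :=
  ∑ u ∈ W, countDiff s u * countDiff t u

lemma sum_countDiff_mul (W : Finset Ω) (v : Ω → ℝ) {n : ℕ} (s : Fin n → Ω × Ω) :
    ∑ u ∈ W, countDiff s u * v u =
      ∑ i, ((W : Set Ω).indicator v (s i).1 - (W : Set Ω).indicator v (s i).2) := by
  simp only [countDiff, Finset.sum_mul, sub_mul, ite_mul, one_mul, zero_mul]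
  rw [Finset.sum_comm]
  simp [Finset.sum_sub_distrib, Set.indicator_apply]

variable [Finite Ω] [MeasurableSpace Ω] [MeasurableSingletonClass Ω] (P Q : Measure Ω)

/-- The law of `n` independent pairs, each consisting of a sample from `P` and an independent
sample from `Q`. -/
abbrev pairLaw (n : ℕ) : Measure (Fin n → Ω × Ω) := Measure.pi fun _ => P.prod Q

variable [IsProbabilityMeasure P] [IsProbabilityMeasure Q] {n : ℕ}

lemma integral_sum_countDiff_mul (W : Finset Ω) (v : Ω → ℝ) :
    ∫ s, ∑ u ∈ W, countDiff s u * v u ∂pairLaw P Q n =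
      n * ∑ u ∈ W, (P.real {u} - Q.real {u}) * v u := by
  set g := (W : Set Ω).indicator v
  have hpair : ∫ z : Ω × Ω, (g z.1 - g z.2) ∂P.prod Q =
      ∑ u ∈ W, (P.real {u} - Q.real {u}) * v u := by
    rw [integral_sub .of_finite .of_finite, integral_fun_fst, integral_fun_snd,
      integral_indicator_eq_sum, integral_indicator_eq_sum]
    simp [sub_mul, Finset.sum_sub_distrib]
  have hcoord (i : Fin n) : ∫ s, (g (s i).1 - g (s i).2) ∂pairLaw P Q n =
      ∑ u ∈ W, (P.real {u} - Q.real {u}) * v u :=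
    (integral_comp_eval (μ := fun _ : Fin n => P.prod Q) (i := i)
      (f := fun z : Ω × Ω => g z.1 - g z.2) .of_discrete).trans hpair
  simp only [sum_countDiff_mul]
  rw [integral_finsetSum _ fun i _ => .of_finite, Finset.sum_congr rfl fun i _ => hcoord i]
  simp

lemma variance_sum_countDiff_mul_le (W : Finset Ω) (v : Ω → ℝ) :
    Var[fun s => ∑ u ∈ W, countDiff s u * v u; pairLaw P Q n] ≤
      n * ∑ u ∈ W, (P.real {u} + Q.real {u}) * v u ^ 2 := by
  set g := (W : Set Ω).indicator v
  have hpair : Var[fun z : Ω × Ω => g z.1 - g z.2; P.prod Q] ≤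
      ∑ u ∈ W, (P.real {u} + Q.real {u}) * v u ^ 2 := by
    have hsub : (fun z : Ω × Ω => g z.1 - g z.2) = fun z => g z.1 + (-g) z.2 := by
      simp [sub_eq_add_neg]
    rw [hsub, variance_add_prod .of_discrete .of_discrete, variance_neg]
    simp only [add_mul, Finset.sum_add_distrib]
    exact add_le_add (variance_indicator_le P W v) (variance_indicator_le Q W v)
  have hsum : (fun s : Fin n → Ω × Ω => ∑ u ∈ W, countDiff s u * v u) =
      ∑ i, fun s => g (s i).1 - g (s i).2 := by
    ext s
    simp [sum_countDiff_mul, g]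
  calc Var[fun s => ∑ u ∈ W, countDiff s u * v u; pairLaw P Q n]
      = ∑ _i : Fin n, Var[fun z : Ω × Ω => g z.1 - g z.2; P.prod Q] := by
        rw [hsum]
        exact variance_sum_pi (μ := fun _ : Fin n => P.prod Q)
          (X := fun _ z => g z.1 - g z.2) fun _ => .of_discrete
    _ ≤ n * ∑ u ∈ W, (P.real {u} + Q.real {u}) * v u ^ 2 := by
        simpa using mul_le_mul_of_nonneg_left hpair n.cast_nonneg

lemma integral_sq_sum_countDiff_mul_le (W : Finset Ω) (v : Ω → ℝ) :
    ∫ s, (∑ u ∈ W, countDiff s u * v u) ^ 2 ∂pairLaw P Q n ≤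
      n * ∑ u ∈ W, (P.real {u} + Q.real {u}) * v u ^ 2 +
        (n * ∑ u ∈ W, (P.real {u} - Q.real {u}) * v u) ^ 2 := by
  have h := variance_sum_countDiff_mul_le P Q (n := n) W v
  rw [variance_eq_sub .of_discrete, integral_sum_countDiff_mul] at h
  simpa using sub_le_iff_le_add.1 h

lemma integral_sq_countDiff_le (u : Ω) :
    ∫ s, countDiff s u ^ 2 ∂pairLaw P Q n ≤
      n * (P.real {u} + Q.real {u}) + n ^ 2 * (P.real {u} - Q.real {u}) ^ 2 := by
  simpa [mul_pow] using integral_sq_sum_countDiff_mul_le P Q (n := n) {u} 1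

lemma integral_collisionStat (W : Finset Ω) :
    ∫ z, collisionStat W z.1 z.2 ∂(pairLaw P Q n).prod (pairLaw P Q n) =
      n ^ 2 * ∑ u ∈ W, (P.real {u} - Q.real {u}) ^ 2 := by
  rw [integral_prod_symm _ .of_finite]
  simp only [collisionStat, integral_sum_countDiff_mul]
  rw [integral_const_mul]
  simp only [mul_comm _ (countDiff _ _), integral_sum_countDiff_mul]
  simp only [sq, mul_assoc]

lemma integral_sq_collisionStat_le (W : Finset Ω) :
    ∫ z, collisionStat W z.1 z.2 ^ 2 ∂(pairLaw P Q n).prod (pairLaw P Q n) ≤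
      n ^ 2 * ∑ u ∈ W, (P.real {u} + Q.real {u}) ^ 2 +
        2 * n ^ 3 * ∑ u ∈ W, (P.real {u} + Q.real {u}) * (P.real {u} - Q.real {u}) ^ 2 +
        (n ^ 2 * ∑ u ∈ W, (P.real {u} - Q.real {u}) ^ 2) ^ 2 := by
  set p := fun u => P.real {u}
  set q := fun u => Q.real {u}
  have hinner := fun t : Fin n → Ω × Ω =>
    integral_sq_sum_countDiff_mul_le P Q (n := n) W (countDiff t)
  have hcoord : ∀ u, (p u + q u) * ∫ t, countDiff t u ^ 2 ∂pairLaw P Q n ≤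
      (p u + q u) * (n * (p u + q u) + n ^ 2 * (p u - q u) ^ 2) := fun u =>
    mul_le_mul_of_nonneg_left (integral_sq_countDiff_le P Q u) (by positivity)
  have hdir := integral_sq_sum_countDiff_mul_le P Q (n := n) W fun u => p u - q u
  calc ∫ z, collisionStat W z.1 z.2 ^ 2 ∂(pairLaw P Q n).prod (pairLaw P Q n)
      ≤ ∫ t, (n * ∑ u ∈ W, (p u + q u) * countDiff t u ^ 2 +
          (n * ∑ u ∈ W, (p u - q u) * countDiff t u) ^ 2) ∂pairLaw P Q n := by
        rw [integral_prod_symm _ .of_finite]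
        exact integral_mono .of_finite .of_finite hinner
    _ = n * ∑ u ∈ W, (p u + q u) * ∫ t, countDiff t u ^ 2 ∂pairLaw P Q n +
          n ^ 2 * ∫ t, (∑ u ∈ W, countDiff t u * (p u - q u)) ^ 2 ∂pairLaw P Q n := by
        rw [integral_add .of_finite .of_finite, integral_const_mul,
          integral_finsetSum _ fun _ _ => .of_finite]
        simp only [integral_const_mul, mul_pow, mul_comm (countDiff _ _)]
    _ ≤ n * ∑ u ∈ W, (p u + q u) * (n * (p u + q u) + n ^ 2 * (p u - q u) ^ 2) +
          n ^ 2 * (n * ∑ u ∈ W, (p u + q u) * (p u - q u) ^ 2 +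
            (n * ∑ u ∈ W, (p u - q u) * (p u - q u)) ^ 2) := by
        gcongr n * ?_ + n ^ 2 * ?_
        exact Finset.sum_le_sum fun u _ => hcoord u
    _ = _ := by
        rw [show ∑ u ∈ W, (p u + q u) * (n * (p u + q u) + n ^ 2 * (p u - q u) ^ 2) =
            n * ∑ u ∈ W, (p u + q u) ^ 2 + n ^ 2 * ∑ u ∈ W, (p u + q u) * (p u - q u) ^ 2 by
          simp only [Finset.mul_sum, ← Finset.sum_add_distrib]
          exact Finset.sum_congr rfl fun u _ => by ring]
        simp only [← sq]
        ring

end PairedSamples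

lemma sum_add_sq_le {ι : Type*} (W : Finset ι) (p q : ι → ℝ) :
    ∑ u ∈ W, (p u + q u) ^ 2 ≤ 8 * ∑ u ∈ W, q u ^ 2 + 2 * ∑ u ∈ W, (p u - q u) ^ 2 := by
  simp only [Finset.mul_sum, ← Finset.sum_add_distrib]
  exact Finset.sum_le_sum fun u _ => by nlinarith [sq_nonneg (p u - 3 * q u)]

lemma abs_le_sqrt_sum_sq {ι : Type*} {W : Finset ι} {u : ι} (hu : u ∈ W) (f : ι → ℝ) :
    |f u| ≤ √(∑ v ∈ W, f v ^ 2) :=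
  Real.abs_le_sqrt (Finset.single_le_sum (f := fun v => f v ^ 2) (fun _ _ => sq_nonneg _) hu)

lemma sum_add_mul_sq_sub_le {ι : Type*} (W : Finset ι) (p q : ι → ℝ) :
    ∑ u ∈ W, (p u + q u) * (p u - q u) ^ 2 ≤
      (√(∑ u ∈ W, (p u - q u) ^ 2) + 2 * √(∑ u ∈ W, q u ^ 2)) * ∑ u ∈ W, (p u - q u) ^ 2 := by
  rw [Finset.mul_sum]
  refine Finset.sum_le_sum fun u hu => mul_le_mul_of_nonneg_right ?_ (sq_nonneg _)
  linarith [le_abs_self (p u - q u), le_abs_self (q u), abs_le_sqrt_sum_sq hu q,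
    abs_le_sqrt_sum_sq hu fun v => p v - q v]

section Concentration

variable {Ω : Type*} [DecidableEq Ω] [Finite Ω] [MeasurableSpace Ω] [MeasurableSingletonClass Ω]
  (P Q : Measure Ω) [IsProbabilityMeasure P] [IsProbabilityMeasure Q] {n : ℕ}

lemma measureReal_collisionStat_ge_le (W : Finset Ω) {τ : ℝ} (hτ : 0 < τ) :
    ((pairLaw Q Q n).prod (pairLaw Q Q n)).real {z | τ ≤ collisionStat W z.1 z.2} ≤
      4 * n ^ 2 * (∑ u ∈ W, Q.real {u} ^ 2) / τ ^ 2 := by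
  calc ((pairLaw Q Q n).prod (pairLaw Q Q n)).real {z | τ ≤ collisionStat W z.1 z.2}
      ≤ ((pairLaw Q Q n).prod (pairLaw Q Q n)).real {z | τ ^ 2 ≤ collisionStat W z.1 z.2 ^ 2} :=
        measureReal_mono fun z (hz : τ ≤ _) => show _ ≤ _ from pow_le_pow_left₀ hτ.le hz 2
    _ ≤ (∫ z, collisionStat W z.1 z.2 ^ 2 ∂(pairLaw Q Q n).prod (pairLaw Q Q n)) / τ ^ 2 :=
        measureReal_ge_le_integral_div (fun _ => sq_nonneg _) .of_finite (by positivity)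
    _ ≤ 4 * n ^ 2 * (∑ u ∈ W, Q.real {u} ^ 2) / τ ^ 2 := by
        gcongr
        refine (integral_sq_collisionStat_le Q Q W).trans_eq ?_
        simp only [← two_mul, mul_pow, ← Finset.mul_sum, sub_self]
        simp
        ring

lemma variance_collisionStat_le (W : Finset Ω) {a b : ℝ}
    (ha : a = n * √(∑ u ∈ W, (P.real {u} - Q.real {u}) ^ 2))
    (hb : b = n * √(∑ u ∈ W, Q.real {u} ^ 2)) :
    Var[fun z => collisionStat W z.1 z.2; (pairLaw P Q n).prod (pairLaw P Q n)] ≤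
      8 * b ^ 2 + 2 * a ^ 2 + 4 * b * a ^ 2 + 2 * a ^ 3 := by
  set M := ∑ u ∈ W, (P.real {u} - Q.real {u}) ^ 2
  set V := ∑ u ∈ W, Q.real {u} ^ 2
  have hM : √M ^ 2 = M := Real.sq_sqrt (by positivity)
  have hV : √V ^ 2 = V := Real.sq_sqrt (by positivity)
  rw [variance_eq_sub .of_discrete, integral_collisionStat, sub_le_iff_le_add]
  refine (integral_sq_collisionStat_le P Q W).trans (add_le_add_left ?_ _)
  calc (n : ℝ) ^ 2 * ∑ u ∈ W, (P.real {u} + Q.real {u}) ^ 2 +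
        2 * n ^ 3 * ∑ u ∈ W, (P.real {u} + Q.real {u}) * (P.real {u} - Q.real {u}) ^ 2
      ≤ n ^ 2 * (8 * V + 2 * M) + 2 * n ^ 3 * ((√M + 2 * √V) * M) := by
        gcongr
        · exact sum_add_sq_le W _ _
        · exact sum_add_mul_sq_sub_le W _ _
    _ = 8 * b ^ 2 + 2 * a ^ 2 + 4 * b * a ^ 2 + 2 * a ^ 3 := by
        rw [ha, hb]
        linear_combination -(8 * n ^ 2 : ℝ) * hV -
          (2 * n ^ 2 + 4 * n ^ 3 * √V + 2 * n ^ 3 * √M) * hM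

lemma four_mul_variance_bound_le {a b : ℝ} (ha : 256 ≤ a) (hb : 0 ≤ b) (hab : 512 * b ≤ a ^ 2) :
    4 * (8 * b ^ 2 + 2 * a ^ 2 + 4 * b * a ^ 2 + 2 * a ^ 3) ≤ a ^ 4 / 8 := by
  have hb2 : 512 ^ 2 * b ^ 2 ≤ a ^ 4 := by nlinarith
  have hba : 512 * (b * a ^ 2) ≤ a ^ 4 := by nlinarith [sq_nonneg a]
  have ha3 : 256 * a ^ 3 ≤ a ^ 4 := by nlinarith [pow_nonneg (by linarith : 0 ≤ a) 3]
  have ha2 : 256 * a ^ 2 ≤ a ^ 3 := by nlinarith [sq_nonneg a]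
  linarith

lemma measureReal_collisionStat_lt_le (W : Finset Ω) {τ : ℝ}
    (hM : 2 ^ 16 ≤ n ^ 2 * ∑ u ∈ W, (P.real {u} - Q.real {u}) ^ 2)
    (hV : 512 * (n * √(∑ u ∈ W, Q.real {u} ^ 2)) ≤
      n ^ 2 * ∑ u ∈ W, (P.real {u} - Q.real {u}) ^ 2)
    (hτ : 2 * τ ≤ n ^ 2 * ∑ u ∈ W, (P.real {u} - Q.real {u}) ^ 2) :
    ((pairLaw P Q n).prod (pairLaw P Q n)).real {z | collisionStat W z.1 z.2 < τ} ≤ 1 / 8 := by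
  set a := n * √(∑ u ∈ W, (P.real {u} - Q.real {u}) ^ 2) with ha
  set b := n * √(∑ u ∈ W, Q.real {u} ^ 2) with hb
  have hmean : n ^ 2 * ∑ u ∈ W, (P.real {u} - Q.real {u}) ^ 2 = a ^ 2 := by
    rw [ha, mul_pow, Real.sq_sqrt (by positivity)]
  rw [hmean] at hM hV hτ
  have ha256 : 256 ≤ a := abs_le_of_sq_le_sq' (by linarith) (by positivity) |>.2
  have hdev : {z : (Fin n → Ω × Ω) × (Fin n → Ω × Ω) | collisionStat W z.1 z.2 < τ} ⊆
      {z | a ^ 2 / 2 ≤ |collisionStat W z.1 z.2 -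
        ∫ z, collisionStat W z.1 z.2 ∂(pairLaw P Q n).prod (pairLaw P Q n)|} := by
    intro z hz
    rw [Set.mem_ofPred_eq] at hz ⊢
    rw [integral_collisionStat, hmean, abs_sub_comm]
    exact le_trans (by linarith) (le_abs_self _)
  calc ((pairLaw P Q n).prod (pairLaw P Q n)).real {z | collisionStat W z.1 z.2 < τ}
      ≤ Var[fun z => collisionStat W z.1 z.2; (pairLaw P Q n).prod (pairLaw P Q n)] /
          (a ^ 2 / 2) ^ 2 :=
        (measureReal_mono hdev).trans
          (measureReal_abs_sub_ge_le_variance_div .of_discrete (by positivity))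
    _ ≤ (8 * b ^ 2 + 2 * a ^ 2 + 4 * b * a ^ 2 + 2 * a ^ 3) / (a ^ 2 / 2) ^ 2 := by
        gcongr
        exact variance_collisionStat_le P Q W ha hb
    _ ≤ 1 / 8 := by
        rw [div_le_iff₀ (by positivity)]
        linarith [four_mul_variance_bound_le ha256 (by positivity : 0 ≤ b) hV]

end Concentration

section Unseen

/-- The symbols that do not occur among the first `m` entries of `a`. -/
def unseen {Y : Type*} [Fintype Y] [DecidableEq Y] {n : ℕ} (m : ℕ) (a : Fin n → Y) : Finset Y :=
  {y | ∀ i : Fin n, i < m → a i ≠ y}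

lemma mul_one_sub_pow_le {r : ℝ} (h0 : 0 ≤ r) (h1 : r ≤ 1) (m : ℕ) :
    r * (1 - r) ^ m ≤ 1 / (m + 1) := by
  have hb := one_add_mul_le_pow (a := r) (by linarith) m
  have hp : 0 ≤ (1 - r) ^ m := pow_nonneg (by linarith) m
  have hprod : (1 + r) ^ m * (1 - r) ^ m ≤ 1 := by
    rw [← mul_pow]
    exact pow_le_one₀ (by nlinarith) (by nlinarith)
  rw [le_div_iff₀ (by positivity)]
  nlinarith [mul_le_mul_of_nonneg_right hb hp]

lemma sq_mul_one_sub_pow_le {r : ℝ} (h0 : 0 ≤ r) (h1 : r ≤ 1) (m : ℕ) :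
    r ^ 2 * (1 - r) ^ m ≤ 4 / (m + 1) ^ 2 := by
  have hpow : (1 - r) ^ m ≤ ((1 - r) ^ (m / 2)) ^ 2 := by
    rw [← pow_mul]
    exact pow_le_pow_of_le_one (by linarith) (by linarith) (by omega)
  have hm : (m : ℝ) + 1 ≤ 2 * ((m / 2 : ℕ) + 1) := by
    exact_mod_cast (by omega : m + 1 ≤ 2 * (m / 2 + 1))
  have hr : 0 ≤ r * (1 - r) ^ (m / 2) := mul_nonneg h0 (pow_nonneg (by linarith) _)
  calc r ^ 2 * (1 - r) ^ m ≤ r ^ 2 * ((1 - r) ^ (m / 2)) ^ 2 := by gcongr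
    _ = (r * (1 - r) ^ (m / 2)) ^ 2 := by ring
    _ ≤ (1 / ((m / 2 : ℕ) + 1)) ^ 2 := pow_le_pow_left₀ hr (mul_one_sub_pow_le h0 h1 _) 2
    _ ≤ (2 / (m + 1)) ^ 2 := by
        gcongr ?_ ^ 2
        rw [div_le_div_iff₀ (by positivity) (by positivity)]
        linarith
    _ = 4 / (m + 1) ^ 2 := by rw [div_pow]; norm_num

/-- An upper bound for the expected squared mass of the symbols of a `d`-letter alphabet that do
not occur among `k - 1` samples. -/
def unseenBound (k d : ℕ) : ℝ := 4 * min (k : ℝ) d / k ^ 2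

variable {Y : Type*} [Fintype Y] [DecidableEq Y] [MeasurableSpace Y] [MeasurableSingletonClass Y]
  (ρ : Measure Y) [IsProbabilityMeasure ρ] {n m : ℕ}

lemma measureReal_mem_unseen (hm : m ≤ n) (y : Y) :
    (Measure.pi fun _ : Fin n => ρ).real {a | y ∈ unseen m a} = (1 - ρ.real {y}) ^ m := by
  have hset : {a : Fin n → Y | y ∈ unseen m a} =
      Set.univ.pi fun i : Fin n => if (i : ℕ) < m then {y}ᶜ else Set.univ := by
    ext a
    simp only [unseen, Set.mem_ofPred_eq, Finset.mem_filter_univ, Set.mem_univ_pi]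
    exact forall_congr' fun i => by split_ifs with hi <;> simp [hi]
  have hcoord (i : Fin n) : ρ.real (if (i : ℕ) < m then {y}ᶜ else Set.univ) =
      if (i : ℕ) < m then 1 - ρ.real {y} else 1 := by
    split_ifs
    · exact probReal_compl_eq_one_sub (measurableSet_singleton y)
    · exact probReal_univ
  have hcard : Fintype.card {i : Fin n // (i : ℕ) < m} = m := by
    simp [Fintype.card_subtype, Fin.card_filter_val_lt, hm]
  rw [hset, measureReal_def, Measure.pi_pi, ENNReal.toReal_prod]
  simp only [← measureReal_def, hcoord, Finset.prod_ite, Finset.prod_const, one_pow, mul_one]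
  rw [← Fintype.card_subtype, hcard]

lemma measureReal_notMem_unseen_le (hm : m ≤ n) (y : Y) :
    (Measure.pi fun _ : Fin n => ρ).real {a | y ∉ unseen m a} ≤ m * ρ.real {y} := by
  have hcompl : {a : Fin n → Y | y ∉ unseen m a} = {a | y ∈ unseen m a}ᶜ := rfl
  rw [hcompl, probReal_compl_eq_one_sub .of_discrete, measureReal_mem_unseen ρ hm]
  have hbernoulli := one_add_mul_le_pow (a := -ρ.real {y})
    (by linarith [measureReal_le_one (μ := ρ) (s := {y})]) m
  rw [← sub_eq_add_neg] at hbernoulli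
  linarith

lemma integral_sum_sq_unseen_le (hm : m ≤ n) :
    ∫ a, ∑ y ∈ unseen m a, ρ.real {y} ^ 2 ∂(Measure.pi fun _ : Fin n => ρ) ≤
      unseenBound (m + 1) (Fintype.card Y) := by
  have hr1 (y : Y) : ρ.real {y} ≤ 1 := measureReal_le_one
  have hmass : ∑ y, ρ.real {y} = 1 := by simp
  have hmean : ∫ a, ∑ y ∈ unseen m a, ρ.real {y} ^ 2 ∂(Measure.pi fun _ : Fin n => ρ) =
      ∑ y, ρ.real {y} ^ 2 * (1 - ρ.real {y}) ^ m := by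
    simp only [integral_sum_mem fun _ => .of_discrete, measureReal_mem_unseen ρ hm]
  rw [hmean, unseenBound, mul_min_of_nonneg _ _ (by norm_num), ← min_div_div_right (by positivity),
    Nat.cast_add_one]
  refine le_min ?_ ?_
  · calc ∑ y, ρ.real {y} ^ 2 * (1 - ρ.real {y}) ^ m
        ≤ ∑ y, ρ.real {y} * (1 / (m + 1)) := by
          refine Finset.sum_le_sum fun y _ => ?_
          rw [sq, mul_assoc]
          gcongr
          exact mul_one_sub_pow_le measureReal_nonneg (hr1 y) m
      _ = 1 / (m + 1) := by rw [← Finset.sum_mul, hmass, one_mul]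
      _ ≤ 4 * (m + 1) / (m + 1) ^ 2 := by
          rw [div_le_div_iff₀ (by positivity) (by positivity)]
          nlinarith
  · calc ∑ y, ρ.real {y} ^ 2 * (1 - ρ.real {y}) ^ m ≤ ∑ _y : Y, 4 / ((m : ℝ) + 1) ^ 2 :=
          Finset.sum_le_sum fun y _ => sq_mul_one_sub_pow_le measureReal_nonneg (hr1 y) m
      _ = 4 * Fintype.card Y / (m + 1) ^ 2 := by
          rw [Finset.sum_const, Finset.card_univ, nsmul_eq_mul]
          ring

end Unseen

section Hellinger

lemma sq_sqrt_sub_sqrt_mul_add_le {x y : ℝ} (hx : 0 ≤ x) (hy : 0 ≤ y) :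
    (√x - √y) ^ 2 * (x + y) ≤ (x - y) ^ 2 :=
  calc (√x - √y) ^ 2 * (x + y) ≤ (√x - √y) ^ 2 * (√x + √y) ^ 2 := by
        gcongr
        nlinarith [Real.sq_sqrt hx, Real.sq_sqrt hy, Real.sqrt_nonneg x, Real.sqrt_nonneg y]
    _ = (√x ^ 2 - √y ^ 2) ^ 2 := by ring
    _ = (x - y) ^ 2 := by rw [Real.sq_sqrt hx, Real.sq_sqrt hy]

lemma sq_sqrt_sub_sqrt_le_abs_sub {x y : ℝ} (hx : 0 ≤ x) (hy : 0 ≤ y) :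
    (√x - √y) ^ 2 ≤ |x - y| :=
  calc (√x - √y) ^ 2 = |√x - √y| * |√x - √y| := by rw [← sq, sq_abs]
    _ ≤ |√x - √y| * (√x + √y) := by
        gcongr
        exact abs_le.2 ⟨by linarith [Real.sqrt_nonneg x], by linarith [Real.sqrt_nonneg y]⟩
    _ = |√x ^ 2 - √y ^ 2| := by
        rw [← abs_of_nonneg (by positivity : 0 ≤ √x + √y), ← abs_mul]
        ring_nf
    _ = |x - y| := by rw [Real.sq_sqrt hx, Real.sq_sqrt hy]

variable {ι : Type*} {p q : ι → ℝ} (hp : ∀ u, 0 ≤ p u) (hq : ∀ u, 0 ≤ q u) (T : Finset ι)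

include hp hq

lemma mul_sum_sq_sqrt_sub_sqrt_le {m : ℝ} (hm : ∀ u ∈ T, m ≤ p u + q u) :
    m * ∑ u ∈ T, (√(p u) - √(q u)) ^ 2 ≤ ∑ u ∈ T, (p u - q u) ^ 2 := by
  rw [Finset.mul_sum]
  refine Finset.sum_le_sum fun u hu => ?_
  rw [mul_comm]
  exact (mul_le_mul_of_nonneg_left (hm u hu) (sq_nonneg _)).trans
    (sq_sqrt_sub_sqrt_mul_add_le (hp u) (hq u))

lemma sq_sum_sq_sqrt_sub_sqrt_le :
    (∑ u ∈ T, (√(p u) - √(q u)) ^ 2) ^ 2 ≤ #T * ∑ u ∈ T, (p u - q u) ^ 2 :=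
  calc (∑ u ∈ T, (√(p u) - √(q u)) ^ 2) ^ 2 ≤ (∑ u ∈ T, |p u - q u|) ^ 2 := by
        gcongr with u
        exact sq_sqrt_sub_sqrt_le_abs_sub (hp u) (hq u)
    _ ≤ #T * ∑ u ∈ T, |p u - q u| ^ 2 := sq_sum_le_card_mul_sum_sq
    _ = #T * ∑ u ∈ T, (p u - q u) ^ 2 := by simp only [sq_abs]

end Hellinger

section Separation

lemma mul_sqrt_mul_sqrt_le {a c m : ℝ} (hc : 0 ≤ c) (hca : c ≤ a) (hcm : c ≤ m) :
    c * √a * √c ≤ a * √c * √m :=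
  calc c * √a * √c = √c * √a * √c * √c := by
        nth_rw 1 [← Real.mul_self_sqrt hc]
        ring
    _ ≤ √a * √a * √c * √m := by gcongr
    _ = a * √c * √m := by rw [Real.mul_self_sqrt (hc.trans hca)]

lemma mul_le_mul_sqrt_mul_sqrt {a c m : ℝ} (ha : 0 ≤ a) (hc : 0 ≤ c) (hcm : c ≤ m) :
    a * c ≤ a * √c * √m :=
  calc a * c = a * √c * √c := by rw [mul_assoc, Real.mul_self_sqrt hc]
    _ ≤ a * √c * √m := by gcongr

lemma separation_of_heavy {n k l L e r F M : ℝ} (hn : 0 ≤ n) (hk : 0 < k) (hl : 0 < l)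
    (hL : 0 ≤ L) (he : 0 ≤ e) (hrF : r ≤ F) (hM : e ≤ 2 ^ 12 * (k * l) * M)
    (h : 2 ^ 50 * L ^ 2 * F ≤ (n * e) ^ 2) :
    2 ^ 11 * L * (n * (4 * √r / (k * l))) ≤ n ^ 2 * M := by
  have hroot : 2 ^ 25 * L * √r ≤ n * e := by
    rw [← Real.sqrt_sq (mul_nonneg hn he), ← Real.sqrt_sq (by positivity : 0 ≤ 2 ^ 25 * L),
      ← Real.sqrt_mul (sq_nonneg _)]
    refine Real.sqrt_le_sqrt (le_trans ?_ h)
    rw [show (2 ^ 25 * L) ^ 2 = 2 ^ 50 * L ^ 2 by ring]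
    gcongr
  calc 2 ^ 11 * L * (n * (4 * √r / (k * l))) = n * (2 ^ 25 * L * √r) / (2 ^ 12 * (k * l)) := by
        rw [eq_div_iff (by positivity)]
        field_simp
        ring
    _ ≤ n * (n * (2 ^ 12 * (k * l) * M)) / (2 ^ 12 * (k * l)) := by
        gcongr n * ?_ / _
        exact hroot.trans (mul_le_mul_of_nonneg_left hM hn)
    _ = n ^ 2 * M := by field_simp

lemma separation_of_light {n l L d d' e m F M : ℝ} (hn : 0 < n) (hl : 0 < l) (hL : 1 ≤ L)
    (hd : 0 < d) (hd' : 0 < d') (hm : 0 ≤ m) (hF : d * √d' * √m ≤ F)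
    (hM : e ^ 2 ≤ d * (64 * min l d') * M) (h : 2 ^ 50 * L ^ 2 * F ≤ (n * e) ^ 2) :
    2 ^ 11 * L * (n * (4 * √(m * min l d') / (n * l))) ≤ n ^ 2 * M := by
  replace h : 2 ^ 19 * L * (d * √d' * √m) ≤ n ^ 2 * e ^ 2 := by
    rw [← mul_pow]
    refine le_trans ?_ h
    gcongr ?_ * ?_
    nlinarith
  set r := min l d'
  have hr : 0 < r := lt_min hl hd'
  have hrr : r * √r ≤ l * √d' :=
    mul_le_mul (min_le_left _ _) (Real.sqrt_le_sqrt (min_le_right _ _)) (by positivity) hl.le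
  calc 2 ^ 11 * L * (n * (4 * √(m * r) / (n * l)))
      = 2 ^ 19 * L * (d * √m * (r * √r)) / (64 * d * r * l) := by
        rw [Real.sqrt_mul hm]
        field_simp
        ring
    _ ≤ 2 ^ 19 * L * (d * √m * (l * √d')) / (64 * d * r * l) := by gcongr
    _ = 2 ^ 19 * L * (d * √d' * √m) / (64 * d * r) := by field_simp
    _ ≤ n ^ 2 * (d * (64 * r) * M) / (64 * d * r) := by
        gcongr ?_ / _
        exact h.trans (mul_le_mul_of_nonneg_left hM (sq_nonneg n))
    _ = n ^ 2 * M := by field_simp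

/-- The `i`-th dyadic scale is the level of a symbol of mass `r` at resolution `I`: the symbol is
unlikely to occur among `2 ^ i - 1` samples, while `r` is at least of order `2 ^ (-i)`, except that
all sufficiently light symbols share the last level `I`. -/
structure IsLevel (I : ℕ) (r : ℝ) (i : ℕ) : Prop where
  le : i ≤ I
  mul_le : ((2 ^ i - 1 : ℕ) : ℝ) * r ≤ 1 / 32
  one_le : i < I → 1 ≤ 64 * 2 ^ i * r

lemma exists_isLevel {r : ℝ} (hr : 0 ≤ r) (I : ℕ) : ∃ i, IsLevel I r i := by
  classical
  let light (i : ℕ) : Prop := ((2 ^ i - 1 : ℕ) : ℝ) * r ≤ 1 / 32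
  have hlight : light (Nat.findGreatest light I) :=
    Nat.findGreatest_spec (Nat.zero_le I) (by simp [light])
  refine ⟨Nat.findGreatest light I, Nat.findGreatest_le I, hlight, fun hlt => ?_⟩
  have hheavy := Nat.findGreatest_is_greatest (Nat.lt_succ_self (Nat.findGreatest light I)) hlt
  generalize Nat.findGreatest light I = i at hheavy ⊢
  simp only [light, Nat.succ_eq_add_one, not_le, Nat.cast_pred (Nat.two_pow_pos _), Nat.cast_pow,
    Nat.cast_ofNat, pow_succ] at hheavy
  linarith

lemma card_le_of_isLevel {Y : Type*} [Fintype Y] [MeasurableSpace Y] [MeasurableSingletonClass Y]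
    (ρ : Measure Y) [IsProbabilityMeasure ρ] {T : Finset Y} {I i : ℕ}
    (hT : ∀ y ∈ T, IsLevel I (ρ.real {y}) i) (hI : i = I → Fintype.card Y ≤ 2 ^ I) :
    (#T : ℝ) ≤ 64 * min ((2 : ℝ) ^ i) (Fintype.card Y) := by
  have hTY : (#T : ℝ) ≤ Fintype.card Y := by exact_mod_cast T.card_le_univ
  rw [mul_min_of_nonneg _ _ (by norm_num)]
  refine le_min ?_ (by linarith [(Fintype.card Y).cast_nonneg (α := ℝ)])
  rcases T.eq_empty_or_nonempty with rfl | ⟨y, hy⟩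
  · simp
  rcases (hT y hy).le.lt_or_eq with hi | rfl
  · calc (#T : ℝ) = ∑ _y ∈ T, (1 : ℝ) := by simp
      _ ≤ ∑ y ∈ T, 64 * 2 ^ i * ρ.real {y} := Finset.sum_le_sum fun y hy => (hT y hy).one_le hi
      _ = 64 * 2 ^ i * ρ.real T := by rw [← Finset.mul_sum, sum_measureReal_singleton]
      _ ≤ 64 * 2 ^ i := mul_le_of_le_one_right (by positivity) measureReal_le_one
  · have : (Fintype.card Y : ℝ) ≤ 2 ^ i := by exact_mod_cast hI rfl
    linarith

lemma sqrt_unseenBound_mul (k l d d' : ℕ) :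
    √(unseenBound k d * unseenBound l d') =
      4 * √(min (k : ℝ) d * min (l : ℝ) d') / (k * l) := by
  rw [show unseenBound k d * unseenBound l d' =
      (4 / (k * l)) ^ 2 * (min (k : ℝ) d * min (l : ℝ) d') by unfold unseenBound; ring,
    Real.sqrt_mul (by positivity), Real.sqrt_sq (by positivity)]
  ring

end Separation

section ProductLevels

variable {A C : Type*} [MeasurableSpace A] [MeasurableSpace C]

lemma sum_sq_sqrt_sub_sqrt_le_of_isLevel (P : Measure (A × C)) (QA : Measure A) (QC : Measure C)
    [SFinite QC] {I i j : ℕ} {T : Finset (A × C)}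
    (hA : ∀ u ∈ T, IsLevel I (QA.real {u.1}) i) (hC : ∀ u ∈ T, IsLevel I (QC.real {u.2}) j)
    (hi : i < I) (hj : j < I) :
    ∑ u ∈ T, (√(P.real {u}) - √((QA.prod QC).real {u})) ^ 2 ≤
      2 ^ 12 * (2 ^ i * 2 ^ j) * ∑ u ∈ T, (P.real {u} - (QA.prod QC).real {u}) ^ 2 := by
  have hmass : ∀ u ∈ T, (2 ^ 12 * (2 ^ i * 2 ^ j) : ℝ)⁻¹ ≤ P.real {u} + (QA.prod QC).real {u} := by
    rintro ⟨a, c⟩ hu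
    have hac := mul_le_mul ((hA _ hu).one_le hi) ((hC _ hu).one_le hj) zero_le_one (by positivity)
    refine le_add_of_nonneg_of_le measureReal_nonneg ?_
    rw [← Set.singleton_prod_singleton, measureReal_prod_prod,
      inv_le_iff_one_le_mul₀ (by positivity)]
    linarith
  exact (inv_mul_le_iff₀ (by positivity)).1 <| mul_sum_sq_sqrt_sub_sqrt_le
    (fun _ => measureReal_nonneg) (fun _ => measureReal_nonneg) T hmass

lemma card_le_of_isLevel_fst [Fintype A] [MeasurableSingletonClass A] {C : Type*} [Fintype C]
    (QA : Measure A) [IsProbabilityMeasure QA] {I i : ℕ} {T : Finset (A × C)}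
    (hA : ∀ u ∈ T, IsLevel I (QA.real {u.1}) i) (hI : i = I → Fintype.card A ≤ 2 ^ I) :
    (#T : ℝ) ≤ Fintype.card C * (64 * min ((2 : ℝ) ^ i) (Fintype.card A)) := by
  classical
  have hT := Finset.card_le_card (Finset.subset_product (s := T))
  rw [Finset.card_product] at hT
  calc (#T : ℝ) ≤ #(T.image Prod.snd) * #(T.image Prod.fst) := by
        rw [mul_comm]
        exact_mod_cast hT
    _ ≤ Fintype.card C * (64 * min ((2 : ℝ) ^ i) (Fintype.card A)) := by
        gcongr
        · exact Finset.card_le_univ _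
        · exact card_le_of_isLevel QA (Finset.forall_mem_image.2 hA) hI

lemma card_le_of_isLevel_snd [Fintype C] [MeasurableSingletonClass C] {A : Type*} [Fintype A]
    (QC : Measure C) [IsProbabilityMeasure QC] {I j : ℕ} {T : Finset (A × C)}
    (hC : ∀ u ∈ T, IsLevel I (QC.real {u.2}) j) (hI : j = I → Fintype.card C ≤ 2 ^ I) :
    (#T : ℝ) ≤ Fintype.card A * (64 * min ((2 : ℝ) ^ j) (Fintype.card C)) := by
  simpa using card_le_of_isLevel_fst QC (T := T.map (Equiv.prodComm A C).toEmbedding)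
    (by simpa using fun c a h => hC (a, c) h) hI

lemma sq_le_mul_sum_sq_sub {Ω : Type*} [MeasurableSpace Ω] (P Q : Measure Ω) {T : Finset Ω}
    {e b : ℝ} (he : 0 ≤ e) (heT : e ≤ ∑ u ∈ T, (√(P.real {u}) - √(Q.real {u})) ^ 2)
    (hT : #T ≤ b) : e ^ 2 ≤ b * ∑ u ∈ T, (P.real {u} - Q.real {u}) ^ 2 :=
  calc e ^ 2 ≤ _ := pow_le_pow_left₀ he heT 2
    _ ≤ _ := sq_sum_sq_sqrt_sub_sqrt_le (fun _ => measureReal_nonneg)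
      (fun _ => measureReal_nonneg) T
    _ ≤ _ := by gcongr

/-- Blocks of length `2 ^ I` are long enough to detect a squared Hellinger distance of order `e`
between distributions on a product of alphabets of sizes `a ≥ c`, when the distance is carried by
symbols of common levels. -/
structure Resolves (a c I : ℕ) (e : ℝ) : Prop where
  pos : 0 < e
  card_le : c ≤ 2 ^ I
  le_sq : 2 ^ 50 * (I + 1 : ℝ) ^ 2 * (a * √c * √(min (2 ^ I) a)) ≤ (2 ^ I * e) ^ 2

lemma two_pow_sixteen_le_mul_sum_sq_sub {A C : Type*} [MeasurableSpace (A × C)] [Fintype A]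
    [Fintype C] [Nonempty A] [Nonempty C] (P Q : Measure (A × C)) {I : ℕ} {T : Finset (A × C)}
    {e : ℝ} (hCA : Fintype.card C ≤ Fintype.card A)
    (he : Resolves (Fintype.card A) (Fintype.card C) I e)
    (heT : e ≤ ∑ u ∈ T, (√(P.real {u}) - √(Q.real {u})) ^ 2) :
    2 ^ 16 ≤ (2 ^ I) ^ 2 * ∑ u ∈ T, (P.real {u} - Q.real {u}) ^ 2 := by
  have ha : (0 : ℝ) < Fintype.card A := by exact_mod_cast Fintype.card_pos
  have hc : (0 : ℝ) < Fintype.card C := by exact_mod_cast Fintype.card_pos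
  set F : ℝ := Fintype.card A * √(Fintype.card C) * √(min (2 ^ I) (Fintype.card A))
  have hF : (Fintype.card A * Fintype.card C : ℝ) ≤ F :=
    mul_le_mul_sqrt_mul_sqrt ha.le hc.le
      (le_min (by exact_mod_cast he.card_le) (by exact_mod_cast hCA))
  have hF0 : 0 < F := (mul_pos ha hc).trans_le hF
  have hcard : (#T : ℝ) ≤ F := by
    refine le_trans ?_ hF
    rw [← Nat.cast_mul, ← Fintype.card_prod]
    exact_mod_cast T.card_le_univ
  refine le_of_mul_le_mul_right ?_ hF0
  calc 2 ^ 16 * F ≤ 2 ^ 50 * (I + 1 : ℝ) ^ 2 * F := by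
        gcongr
        nlinarith [(Nat.cast_nonneg I : (0 : ℝ) ≤ I)]
    _ ≤ (2 ^ I) ^ 2 * e ^ 2 := by simpa only [mul_pow] using he.le_sq
    _ ≤ (2 ^ I) ^ 2 * (F * ∑ u ∈ T, (P.real {u} - Q.real {u}) ^ 2) := by
        gcongr
        exact sq_le_mul_sum_sq_sub P Q he.pos.le heT hcard
    _ = (2 ^ I) ^ 2 * (∑ u ∈ T, (P.real {u} - Q.real {u}) ^ 2) * F := by ring

lemma le_mul_sum_sq_sub_of_isLevel [Fintype A] [Fintype C] [MeasurableSingletonClass A]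
    [MeasurableSingletonClass C] (P : Measure (A × C)) (QA : Measure A) (QC : Measure C)
    [IsProbabilityMeasure QA] [IsProbabilityMeasure QC] {I i j : ℕ} {T : Finset (A × C)} {e : ℝ}
    (hA : ∀ u ∈ T, IsLevel I (QA.real {u.1}) i) (hC : ∀ u ∈ T, IsLevel I (QC.real {u.2}) j)
    (hi : i ≤ I) (hj : j ≤ I) (hCA : Fintype.card C ≤ Fintype.card A)
    (he : Resolves (Fintype.card A) (Fintype.card C) I e)
    (heT : e ≤ ∑ u ∈ T, (√(P.real {u}) - √((QA.prod QC).real {u})) ^ 2) :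
    2 ^ 11 * (I + 1 : ℝ) * (2 ^ I *
      √(unseenBound (2 ^ i) (Fintype.card A) * unseenBound (2 ^ j) (Fintype.card C))) ≤
      (2 ^ I) ^ 2 * ∑ u ∈ T, (P.real {u} - (QA.prod QC).real {u}) ^ 2 := by
  have := nonempty_of_isProbabilityMeasure QA
  have := nonempty_of_isProbabilityMeasure QC
  have ha : (0 : ℝ) < Fintype.card A := by exact_mod_cast Fintype.card_pos
  have hc : (0 : ℝ) < Fintype.card C := by exact_mod_cast Fintype.card_pos
  have hca : (Fintype.card C : ℝ) ≤ Fintype.card A := by exact_mod_cast hCA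
  have hcn : (Fintype.card C : ℝ) ≤ 2 ^ I := by exact_mod_cast he.card_le
  have hcm : (Fintype.card C : ℝ) ≤ min ((2 : ℝ) ^ I) (Fintype.card A) := le_min hcn hca
  have hcauchy {b : ℝ} (hT : #T ≤ b) :=
    sq_le_mul_sum_sq_sub P (QA.prod QC) he.pos.le heT hT
  rw [sqrt_unseenBound_mul, Nat.cast_pow, Nat.cast_pow, Nat.cast_ofNat]
  rcases hi.eq_or_lt with rfl | hi
  · refine separation_of_light (by positivity) (by positivity) (by simp) ha hc (by positivity)
      le_rfl (hcauchy (card_le_of_isLevel_snd QC hC fun _ => he.card_le)) he.le_sq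
  rcases hj.eq_or_lt with rfl | hj
  · rw [min_eq_right hcn, mul_comm (min _ _), mul_comm ((2 : ℝ) ^ i)]
    exact separation_of_light (by positivity) (by positivity) (by simp) hc ha hc.le
      (mul_sqrt_mul_sqrt_le hc.le hca hcm)
      (hcauchy (card_le_of_isLevel_fst QA hA fun h => absurd h hi.ne)) he.le_sq
  · exact separation_of_heavy (by positivity) (by positivity) (by positivity) (by positivity)
      he.pos.le
      ((mul_le_mul (min_le_right _ _) (min_le_right _ _) (by positivity) ha.le).trans
        (mul_le_mul_sqrt_mul_sqrt ha.le hc.le hcm))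
      (heT.trans (sum_sq_sqrt_sub_sqrt_le_of_isLevel P QA QC hA hC hi hj)) he.le_sq

end ProductLevels

section Rejection

lemma two_pow_sub_one_le {i I : ℕ} (hi : i ≤ I) : 2 ^ i - 1 ≤ 2 ^ I :=
  (Nat.sub_le _ _).trans (Nat.pow_le_pow_right two_pos hi)

lemma integral_sum_sq_unseen_two_pow_le {Y : Type*} [Fintype Y] [DecidableEq Y] [MeasurableSpace Y]
    [MeasurableSingletonClass Y] (ρ : Measure Y) [IsProbabilityMeasure ρ] {i I : ℕ} (hi : i ≤ I) :
    ∫ a, ∑ y ∈ unseen (2 ^ i - 1) a, ρ.real {y} ^ 2 ∂(Measure.pi fun _ : Fin (2 ^ I) => ρ) ≤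
      unseenBound (2 ^ i) (Fintype.card Y) := by
  simpa only [Nat.sub_add_cancel Nat.one_le_two_pow] using
    integral_sum_sq_unseen_le ρ (two_pow_sub_one_le hi)

variable {A C : Type*} [Fintype A] [Fintype C] [DecidableEq A] [DecidableEq C] {I i j : ℕ}

/-- The pairs both of whose coordinates are unseen: the first among the first `2 ^ i - 1` entries
of an auxiliary sample of `A`, the second among the first `2 ^ j - 1` of one of `C`. -/
def unseenRect {n : ℕ} (i j : ℕ) (r : (Fin n → A) × (Fin n → C)) : Finset (A × C) :=
  unseen (2 ^ i - 1) r.1 ×ˢ unseen (2 ^ j - 1) r.2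

variable (A C) in
/-- The rejection threshold for the collision statistic on `unseenRect i j`, a multiple of a bound
for its standard deviation under equal distributions. -/
def threshold (I i j : ℕ) : ℝ :=
  4 * (I + 1) * 2 ^ I *
    √(unseenBound (2 ^ i) (Fintype.card A) * unseenBound (2 ^ j) (Fintype.card C))

variable (A C) in
/-- The space of the data on which the test of resolution `I` is based: auxiliary samples of each
coordinate, and two blocks of paired samples. -/
abbrev TestData (I : ℕ) : Type _ :=
  ((Fin (2 ^ I) → A) × (Fin (2 ^ I) → C)) ×
    ((Fin (2 ^ I) → (A × C) × (A × C)) × (Fin (2 ^ I) → (A × C) × (A × C)))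

variable (A C) in
/-- The event that, for some pair of scales, the collision statistic reaches its threshold. -/
def rejection (I : ℕ) : Set (TestData A C I) :=
  ⋃ l ∈ Finset.Iic I ×ˢ Finset.Iic I,
    {x | threshold A C I l.1 l.2 ≤ collisionStat (unseenRect l.1 l.2 x.1) x.2.1 x.2.2}

variable [MeasurableSpace A] [MeasurableSpace C] [MeasurableSingletonClass A]
  [MeasurableSingletonClass C] (P : Measure (A × C)) (QA : Measure A) (QC : Measure C)
  [IsProbabilityMeasure P] [IsProbabilityMeasure QA] [IsProbabilityMeasure QC]

/-- The law of the auxiliary samples: independent samples of each coordinate. -/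
abbrev auxLaw (n : ℕ) : Measure ((Fin n → A) × (Fin n → C)) :=
  (Measure.pi fun _ => QA).prod (Measure.pi fun _ => QC)

/-- The law of the test data when testing `P` against `QA.prod QC`. -/
abbrev testLaw (I : ℕ) : Measure (TestData A C I) :=
  (auxLaw QA QC (2 ^ I)).prod
    ((pairLaw P (QA.prod QC) (2 ^ I)).prod (pairLaw P (QA.prod QC) (2 ^ I)))

instance {A C : Type*} [Finite A] [Finite C] [MeasurableSpace A] [MeasurableSpace C]
    [MeasurableSingletonClass A] [MeasurableSingletonClass C] (I : ℕ) :
    DiscreteMeasurableSpace (TestData A C I) :=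
  MeasurableSingletonClass.toDiscreteMeasurableSpace

lemma integral_sum_sq_unseenRect_le (hi : i ≤ I) (hj : j ≤ I) :
    ∫ r, ∑ u ∈ unseenRect i j r, (QA.prod QC).real {u} ^ 2 ∂auxLaw QA QC (2 ^ I) ≤
      unseenBound (2 ^ i) (Fintype.card A) * unseenBound (2 ^ j) (Fintype.card C) := by
  have hprod (r : (Fin (2 ^ I) → A) × (Fin (2 ^ I) → C)) :
      ∑ u ∈ unseenRect i j r, (QA.prod QC).real {u} ^ 2 =
        (∑ a ∈ unseen (2 ^ i - 1) r.1, QA.real {a} ^ 2) *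
          ∑ c ∈ unseen (2 ^ j - 1) r.2, QC.real {c} ^ 2 := by
    simp only [unseenRect, Finset.sum_product, Finset.sum_mul_sum, ← Set.singleton_prod_singleton,
      measureReal_prod_prod, mul_pow]
  simp only [hprod]
  rw [integral_prod_mul (fun a => ∑ y ∈ unseen (2 ^ i - 1) a, QA.real {y} ^ 2)
    fun c => ∑ y ∈ unseen (2 ^ j - 1) c, QC.real {y} ^ 2]
  exact mul_le_mul (integral_sum_sq_unseen_two_pow_le QA hi)
    (integral_sum_sq_unseen_two_pow_le QC hj)
    (integral_nonneg fun _ => by positivity) (by unfold unseenBound; positivity)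

lemma measureReal_notMem_unseenRect_le {u : A × C} (hA : IsLevel I (QA.real {u.1}) i)
    (hC : IsLevel I (QC.real {u.2}) j) :
    (auxLaw QA QC (2 ^ I)).real {r | u ∉ unseenRect i j r} ≤ 1 / 16 := by
  have hunion : {r : (Fin (2 ^ I) → A) × (Fin (2 ^ I) → C) | u ∉ unseenRect i j r} =
      {a | u.1 ∉ unseen (2 ^ i - 1) a} ×ˢ Set.univ ∪
        Set.univ ×ˢ {c | u.2 ∉ unseen (2 ^ j - 1) c} := by
    ext r
    simp [unseenRect, Finset.mem_product, imp_iff_not_or]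
  calc (auxLaw QA QC (2 ^ I)).real {r | u ∉ unseenRect i j r}
      ≤ ((2 ^ i - 1 : ℕ) : ℝ) * QA.real {u.1} + ((2 ^ j - 1 : ℕ) : ℝ) * QC.real {u.2} := by
        rw [hunion]
        refine (measureReal_union_le _ _).trans ?_
        rw [measureReal_prod_prod, measureReal_prod_prod, probReal_univ, probReal_univ, mul_one,
          one_mul]
        exact add_le_add (measureReal_notMem_unseen_le QA (two_pow_sub_one_le hA.le) _)
          (measureReal_notMem_unseen_le QC (two_pow_sub_one_le hC.le) _)
    _ ≤ 1 / 16 := by linarith [hA.mul_le, hC.mul_le]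

lemma unseenBound_pos {k d : ℕ} (hk : 0 < k) (hd : 0 < d) : 0 < unseenBound k d := by
  unfold unseenBound
  positivity

lemma testLaw_threshold_le_collisionStat_le (hi : i ≤ I) (hj : j ≤ I) :
    (testLaw (QA.prod QC) QA QC I).real
      {x | threshold A C I i j ≤ collisionStat (unseenRect i j x.1) x.2.1 x.2.2} ≤
      1 / (4 * (I + 1) ^ 2) := by
  have := nonempty_of_isProbabilityMeasure QA
  have := nonempty_of_isProbabilityMeasure QC
  set β := unseenBound (2 ^ i) (Fintype.card A) * unseenBound (2 ^ j) (Fintype.card C) with hβ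
  have hβ0 : 0 < β := mul_pos (unseenBound_pos (by positivity) Fintype.card_pos)
    (unseenBound_pos (by positivity) Fintype.card_pos)
  have hτ : threshold A C I i j ^ 2 = 16 * (I + 1) ^ 2 * (2 ^ I) ^ 2 * β := by
    rw [threshold, mul_pow, Real.sq_sqrt hβ0.le]
    ring
  have hτ0 : 0 < threshold A C I i j := by
    rw [threshold, ← hβ]
    positivity
  calc _ ≤ ∫ r, 4 * ((2 ^ I : ℕ) : ℝ) ^ 2 *
          (∑ u ∈ unseenRect i j r, (QA.prod QC).real {u} ^ 2) / threshold A C I i j ^ 2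
          ∂auxLaw QA QC (2 ^ I) :=
        measureReal_prod_le_integral .of_discrete .of_finite fun r =>
          measureReal_collisionStat_ge_le (QA.prod QC) (unseenRect i j r) hτ0
    _ ≤ 4 * ((2 ^ I : ℕ) : ℝ) ^ 2 * β / threshold A C I i j ^ 2 := by
        rw [integral_div, integral_const_mul]
        gcongr
        exact integral_sum_sq_unseenRect_le QA QC hi hj
    _ = 1 / (4 * (I + 1) ^ 2) := by
        rw [hτ]
        push_cast
        field_simp
        norm_num

lemma testLaw_rejection_le (I : ℕ) :
    (testLaw (QA.prod QC) QA QC I).real (rejection A C I) ≤ 1 / 4 :=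
  calc _ ≤ _ := measureReal_biUnion_finset_le _ _
    _ ≤ ∑ _l ∈ Finset.Iic I ×ˢ Finset.Iic I, (1 / (4 * (I + 1) ^ 2) : ℝ) := by
        refine Finset.sum_le_sum fun l hl => ?_
        rw [Finset.mem_product, Finset.mem_Iic, Finset.mem_Iic] at hl
        exact testLaw_threshold_le_collisionStat_le QA QC hl.1 hl.2
    _ = 1 / 4 := by
        rw [Finset.sum_const, Finset.card_product, Nat.card_Iic, nsmul_eq_mul]
        push_cast
        field_simp

end Rejection

section Soundness

lemma exists_isLevel_sum_ge {A C : Type*} [Fintype A] [Fintype C] {qa : A → ℝ} {qc : C → ℝ}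
    (hqa : ∀ a, 0 ≤ qa a) (hqc : ∀ c, 0 ≤ qc c) (I : ℕ) {h : A × C → ℝ} {D : ℝ}
    (hD : (I + 1) ^ 2 * D ≤ ∑ u, h u) :
    ∃ i ≤ I, ∃ j ≤ I, ∃ T : Finset (A × C), (∀ u ∈ T, IsLevel I (qa u.1) i) ∧
      (∀ u ∈ T, IsLevel I (qc u.2) j) ∧ D ≤ ∑ u ∈ T, h u := by
  classical
  choose levelA hlevelA using fun a => exists_isLevel (hqa a) I
  choose levelC hlevelC using fun c => exists_isLevel (hqc c) I
  obtain ⟨⟨i, j⟩, hij, hsum⟩ := Finset.exists_le_sum_fiber_of_maps_to_of_nsmul_le_sum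
    (s := Finset.univ) (t := Finset.Iic I ×ˢ Finset.Iic I)
    (f := fun u : A × C => (levelA u.1, levelC u.2)) (w := h) (b := D)
    (fun u _ => Finset.mk_mem_product (Finset.mem_Iic.2 (hlevelA u.1).le)
      (Finset.mem_Iic.2 (hlevelC u.2).le))
    ⟨(0, 0), by simp⟩
    (by simpa [Finset.card_product, ← sq] using hD)
  rw [Finset.mem_product, Finset.mem_Iic, Finset.mem_Iic] at hij
  refine ⟨i, hij.1, j, hij.2, _, fun u hu => ?_, fun u hu => ?_, hsum⟩ <;>
    obtain ⟨rfl, rfl⟩ := Prod.mk.injEq .. ▸ (Finset.mem_filter_univ u).1 hu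
  · exact hlevelA u.1
  · exact hlevelC u.2

lemma measureReal_sum_filter_notMem_ge_le {S ι : Type*} [MeasurableSpace S] [Finite ι]
    [DecidableEq ι] {σ : Measure S} [IsFiniteMeasure σ] {R : S → Finset ι}
    (hR : ∀ u, MeasurableSet {s | u ∈ R s}) {T : Finset ι} {h : ι → ℝ} (h0 : ∀ u, 0 ≤ h u) {δ : ℝ}
    (hδ : ∀ u ∈ T, σ.real {s | u ∉ R s} ≤ δ) (hT : 0 < ∑ u ∈ T, h u) :
    σ.real {s | (∑ u ∈ T, h u) / 2 ≤ ∑ u ∈ T with u ∉ R s, h u} ≤ 2 * δ := by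
  cases nonempty_fintype ι
  have hmeas (u : ι) : MeasurableSet {s | u ∈ T.filter (· ∉ R s)} := by
    simp only [Finset.mem_filter, Set.ofPred_and]
    exact (MeasurableSet.const _).inter (hR u).compl
  have hmean : ∫ s, ∑ u ∈ T with u ∉ R s, h u ∂σ ≤ (∑ u ∈ T, h u) * δ := by
    rw [integral_sum_mem hmeas, Finset.sum_mul, ← Finset.sum_subset T.subset_univ]
    · refine Finset.sum_le_sum fun u hu => mul_le_mul_of_nonneg_left ?_ (h0 u)
      simpa only [Finset.mem_filter, hu, true_and] using hδ u hu
    · intro u _ hu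
      simp [hu]
  refine (measureReal_ge_le_integral_div (fun s => Finset.sum_nonneg fun u _ => h0 u)
    (integrable_sum_mem hmeas h) (half_pos hT)).trans ?_
  rw [div_le_iff₀ (half_pos hT)]
  linarith

variable {A C : Type*} [Fintype A] [Fintype C] [DecidableEq A] [DecidableEq C]
  [MeasurableSpace A] [MeasurableSpace C] [MeasurableSingletonClass A]
  [MeasurableSingletonClass C] (P : Measure (A × C)) (QA : Measure A) (QC : Measure C)
  [IsProbabilityMeasure P] [IsProbabilityMeasure QA] [IsProbabilityMeasure QC] {I i j : ℕ}

lemma measureReal_sum_sq_unseenRect_ge_le (hi : i ≤ I) (hj : j ≤ I) :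
    (auxLaw QA QC (2 ^ I)).real {r |
      16 * (unseenBound (2 ^ i) (Fintype.card A) * unseenBound (2 ^ j) (Fintype.card C)) ≤
        ∑ u ∈ unseenRect i j r, (QA.prod QC).real {u} ^ 2} ≤ 1 / 16 := by
  have := nonempty_of_isProbabilityMeasure QA
  have := nonempty_of_isProbabilityMeasure QC
  have hβ := mul_pos (unseenBound_pos (k := 2 ^ i) (by positivity) (Fintype.card_pos (α := A)))
    (unseenBound_pos (k := 2 ^ j) (by positivity) (Fintype.card_pos (α := C)))
  refine (measureReal_ge_le_integral_div (fun _ => by positivity) .of_finite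
    (by positivity)).trans ?_
  rw [div_le_iff₀ (by positivity)]
  linarith [integral_sum_sq_unseenRect_le QA QC hi hj]

lemma pairLaw_collisionStat_lt_threshold_le {T W : Finset (A × C)} {e : ℝ}
    (hA : ∀ u ∈ T, IsLevel I (QA.real {u.1}) i) (hC : ∀ u ∈ T, IsLevel I (QC.real {u.2}) j)
    (hi : i ≤ I) (hj : j ≤ I) (hCA : Fintype.card C ≤ Fintype.card A)
    (he : Resolves (Fintype.card A) (Fintype.card C) I e) (hTW : T ⊆ W)
    (heT : e ≤ ∑ u ∈ T, (√(P.real {u}) - √((QA.prod QC).real {u})) ^ 2)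
    (hV : ∑ u ∈ W, (QA.prod QC).real {u} ^ 2 ≤
      16 * (unseenBound (2 ^ i) (Fintype.card A) * unseenBound (2 ^ j) (Fintype.card C))) :
    ((pairLaw P (QA.prod QC) (2 ^ I)).prod (pairLaw P (QA.prod QC) (2 ^ I))).real
      {z | collisionStat W z.1 z.2 < threshold A C I i j} ≤ 1 / 8 := by
  have := nonempty_of_isProbabilityMeasure QA
  have := nonempty_of_isProbabilityMeasure QC
  set β := unseenBound (2 ^ i) (Fintype.card A) * unseenBound (2 ^ j) (Fintype.card C) with hβ
  have hmono : ∑ u ∈ T, (P.real {u} - (QA.prod QC).real {u}) ^ 2 ≤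
      ∑ u ∈ W, (P.real {u} - (QA.prod QC).real {u}) ^ 2 :=
    Finset.sum_le_sum_of_subset_of_nonneg hTW fun _ _ _ => sq_nonneg _
  have hsep : 2 ^ 11 * (I + 1 : ℝ) * (2 ^ I * √β) ≤
      (2 ^ I) ^ 2 * ∑ u ∈ W, (P.real {u} - (QA.prod QC).real {u}) ^ 2 :=
    (le_mul_sum_sq_sub_of_isLevel P QA QC hA hC hi hj hCA he heT).trans (by gcongr)
  have hnonneg : 0 ≤ 2 ^ I * √β := by positivity
  have hsqrtV : √(∑ u ∈ W, (QA.prod QC).real {u} ^ 2) ≤ 4 * √β := by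
    refine (Real.sqrt_le_sqrt hV).trans_eq ?_
    rw [Real.sqrt_mul (by norm_num), show (16 : ℝ) = 4 ^ 2 by norm_num,
      Real.sqrt_sq (by norm_num)]
  refine measureReal_collisionStat_lt_le P (QA.prod QC) W ?_ ?_ ?_ <;> push_cast
  · exact (two_pow_sixteen_le_mul_sum_sq_sub P _ hCA he heT).trans (by gcongr)
  · calc 512 * (2 ^ I * √(∑ u ∈ W, (QA.prod QC).real {u} ^ 2)) ≤ 512 * (2 ^ I * (4 * √β)) := by
          gcongr
      _ ≤ 2 ^ 11 * (I + 1 : ℝ) * (2 ^ I * √β) := by nlinarith [(Nat.cast_nonneg I : (0 : ℝ) ≤ I)]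
      _ ≤ _ := hsep
  · rw [threshold, ← hβ]
    nlinarith [(Nat.cast_nonneg I : (0 : ℝ) ≤ I)]

lemma testLaw_compl_rejection_le {e : ℝ} (hCA : Fintype.card C ≤ Fintype.card A)
    (he : Resolves (Fintype.card A) (Fintype.card C) I e)
    (hP : (I + 1) ^ 2 * (2 * e) ≤ ∑ u, (√(P.real {u}) - √((QA.prod QC).real {u})) ^ 2) :
    (testLaw P QA QC I).real (rejection A C I)ᶜ ≤ 5 / 16 := by
  obtain ⟨i, hi, j, hj, T, hA, hC, hT⟩ := exists_isLevel_sum_ge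
    (qa := fun a => QA.real {a}) (qc := fun c => QC.real {c})
    (fun _ => measureReal_nonneg) (fun _ => measureReal_nonneg) I hP
  set h := fun u => (√(P.real {u}) - √((QA.prod QC).real {u})) ^ 2
  set lossy := {r : (Fin (2 ^ I) → A) × (Fin (2 ^ I) → C) |
    (∑ u ∈ T, h u) / 2 ≤ ∑ u ∈ T with u ∉ unseenRect i j r, h u}
  set heavy := {r : (Fin (2 ^ I) → A) × (Fin (2 ^ I) → C) |
    16 * (unseenBound (2 ^ i) (Fintype.card A) * unseenBound (2 ^ j) (Fintype.card C)) ≤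
      ∑ u ∈ unseenRect i j r, (QA.prod QC).real {u} ^ 2}
  have hlossy : (auxLaw QA QC (2 ^ I)).real lossy ≤ 2 * (1 / 16) :=
    measureReal_sum_filter_notMem_ge_le (fun _ => .of_discrete) (fun _ => sq_nonneg _)
      (fun u hu => measureReal_notMem_unseenRect_le QA QC (hA u hu) (hC u hu))
      ((by linarith [he.pos] : 0 < 2 * e).trans_le hT)
  have hheavy : (auxLaw QA QC (2 ^ I)).real heavy ≤ 1 / 16 :=
    measureReal_sum_sq_unseenRect_ge_le QA QC hi hj
  have haccept : (testLaw P QA QC I).real (rejection A C I)ᶜ ≤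
      (auxLaw QA QC (2 ^ I)).real (lossy ∪ heavy) + 1 / 8 := by
    refine measureReal_prod_le_add .of_discrete .of_discrete (by norm_num) fun r hr => ?_
    obtain ⟨hloss, hV⟩ : ¬ _ ∧ ¬ _ := not_or.1 hr
    rw [Set.mem_ofPred_eq, not_le] at hloss hV
    have hkept : e ≤ ∑ u ∈ T with u ∈ unseenRect i j r, h u := by
      linarith [Finset.sum_filter_add_sum_filter_not T (· ∈ unseenRect i j r) h]
    refine (measureReal_mono fun z hz => ?_).trans <| pairLaw_collisionStat_lt_threshold_le P QA QC
      (fun u hu => hA u (Finset.mem_filter.1 hu).1) (fun u hu => hC u (Finset.mem_filter.1 hu).1)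
      hi hj hCA he (fun u hu => (Finset.mem_filter.1 hu).2) hkept hV.le
    contrapose! hz
    simp only [Set.mem_ofPred_eq, not_lt] at hz
    exact not_not_intro <| Set.mem_biUnion
      (Finset.mk_mem_product (Finset.mem_Iic.2 hi) (Finset.mem_Iic.2 hj)) hz
  linarith [measureReal_union_le (μ := auxLaw QA QC (2 ^ I)) lossy heavy]

end Soundness

section SampleSize

/-- The sample size of the theorem up to constant and logarithmic factors, for alphabets of sizes
`a` and `c` and squared Hellinger distance `ε`. -/
def rate (a c ε : ℝ) : ℝ :=
  min (a ^ (3 / 4 : ℝ) * c ^ (1 / 4 : ℝ) / ε) (a ^ (2 / 3 : ℝ) * c ^ (1 / 3 : ℝ) / ε ^ (4 / 3 : ℝ))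

variable {a c ε : ℝ}

lemma rate_nonneg (ha : 0 ≤ a) (hc : 0 ≤ c) (hε : 0 ≤ ε) : 0 ≤ rate a c ε := by
  unfold rate
  positivity

lemma le_rpow_mul_rpow (hc : 0 < c) (hca : c ≤ a) {s t : ℝ} (hs : 0 ≤ s) (hst : s + t = 1) :
    c ≤ a ^ s * c ^ t :=
  calc c = c ^ s * c ^ t := by rw [← Real.rpow_add hc, hst, Real.rpow_one]
    _ ≤ a ^ s * c ^ t := by gcongr

lemma le_rate (hc : 0 < c) (hca : c ≤ a) (hε : 0 < ε) (hε1 : ε ≤ 1) : c ≤ rate a c ε := by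
  have ha : 0 < a := hc.trans_le hca
  have hpow : ε ^ (4 / 3 : ℝ) ≤ 1 := Real.rpow_le_one hε.le hε1 (by norm_num)
  refine le_min ?_ ?_
  · exact (le_rpow_mul_rpow hc hca (by norm_num) (by norm_num)).trans
      (le_div_self (by positivity) hε hε1)
  · exact (le_rpow_mul_rpow hc hca (by norm_num) (by norm_num)).trans
      (le_div_self (by positivity) (by positivity) hpow)

lemma rate_le (ha : 1 ≤ a) (hc : 1 ≤ c) (hε : 0 ≤ ε) : rate a c ε ≤ a * c / ε := by
  refine (min_le_left _ _).trans ?_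
  gcongr
  · exact Real.rpow_le_self_of_one_le ha (by norm_num)
  · exact Real.rpow_le_self_of_one_le hc (by norm_num)

lemma sq_rpow_three_quarters_mul_rpow_quarter (ha : 0 < a) (hc : 0 ≤ c) :
    (a ^ (3 / 4 : ℝ) * c ^ (1 / 4 : ℝ)) ^ 2 = a * √c * √a := by
  rw [mul_pow, ← Real.rpow_mul_natCast ha.le, ← Real.rpow_mul_natCast hc, Real.sqrt_eq_rpow,
    Real.sqrt_eq_rpow, mul_right_comm, ← Real.rpow_one_add' ha.le (by norm_num)]
  norm_num

lemma rpow_three_halves_second_rate (ha : 0 ≤ a) (hc : 0 ≤ c) (hε : 0 ≤ ε) :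
    (a ^ (2 / 3 : ℝ) * c ^ (1 / 3 : ℝ) / ε ^ (4 / 3 : ℝ)) ^ (3 / 2 : ℝ) = a * √c / ε ^ 2 := by
  rw [Real.div_rpow (by positivity) (by positivity), Real.mul_rpow (by positivity) (by positivity),
    ← Real.rpow_mul ha, ← Real.rpow_mul hc, ← Real.rpow_mul hε, Real.sqrt_eq_rpow,
    ← Real.rpow_natCast ε]
  norm_num

lemma rpow_three_halves_mul_le_sq {n B : ℝ} (hn : 0 < n) (ha : 0 < a) (hc : 0 ≤ c) (hε : 0 < ε)
    (hB : 1 ≤ B) (h : B * rate a c ε ≤ n) :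
    B ^ (3 / 2 : ℝ) * (a * √c * √(min n a)) ≤ (n * ε) ^ 2 := by
  have hB0 : 0 < B := by linarith
  rcases min_choice (a ^ (3 / 4 : ℝ) * c ^ (1 / 4 : ℝ) / ε)
      (a ^ (2 / 3 : ℝ) * c ^ (1 / 3 : ℝ) / ε ^ (4 / 3 : ℝ)) with hmin | hmin <;>
    rw [rate, hmin] at h
  · rw [mul_div_assoc', div_le_iff₀ hε] at h
    calc B ^ (3 / 2 : ℝ) * (a * √c * √(min n a)) ≤ B ^ 2 * (a * √c * √a) := by
          gcongr
          · rw [← Real.rpow_natCast]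
            exact Real.rpow_le_rpow_of_exponent_le hB (by norm_num)
          · exact min_le_right _ _
      _ = (B * (a ^ (3 / 4 : ℝ) * c ^ (1 / 4 : ℝ))) ^ 2 := by
          rw [mul_pow, sq_rpow_three_quarters_mul_rpow_quarter ha hc]
      _ ≤ (n * ε) ^ 2 := by gcongr
  · have hpow := Real.rpow_le_rpow (by positivity) h (by norm_num : (0 : ℝ) ≤ 3 / 2)
    rw [Real.mul_rpow hB0.le (by positivity), rpow_three_halves_second_rate ha.le hc hε.le,
      mul_div_assoc', div_le_iff₀ (by positivity)] at hpow
    calc B ^ (3 / 2 : ℝ) * (a * √c * √(min n a)) ≤ B ^ (3 / 2 : ℝ) * (a * √c) * √n := by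
          rw [← mul_assoc]
          gcongr
          exact min_le_left _ _
      _ ≤ n ^ (3 / 2 : ℝ) * ε ^ 2 * √n := by gcongr
      _ = (n * ε) ^ 2 := by
          rw [mul_right_comm, Real.sqrt_eq_rpow, ← Real.rpow_add hn, mul_pow, ← Real.rpow_natCast n]
          norm_num

lemma one_le_log_two_add {x : ℝ} (hx : 1 ≤ x) : 1 ≤ Real.log (2 + x) := by
  rw [Real.le_log_iff_exp_le (by positivity)]
  linarith [Real.exp_one_lt_d9]

lemma add_one_le_two_pow_seven_mul_log {x : ℝ} {i : ℕ} (hx : 1 ≤ x)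
    (hi : 2 ^ i ≤ 2 ^ 65 * Real.log (2 + x) ^ 4 * x) : i + 1 ≤ 2 ^ 7 * Real.log (2 + x) := by
  have hΛ := one_le_log_two_add hx
  set Λ := Real.log (2 + x)
  have hlog := Real.log_le_log (by positivity) hi
  rw [Real.log_mul (by positivity) (by positivity), Real.log_mul (by positivity) (by positivity),
    Real.log_pow, Real.log_pow, Real.log_pow] at hlog
  push_cast at hlog
  have hlogΛ : Real.log Λ ≤ Λ := (Real.log_le_sub_one_of_pos (by linarith)).trans (by linarith)
  have hlogx : Real.log x ≤ Λ := Real.log_le_log (by linarith) (by linarith)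
  have hlog2 : 1 / 2 < Real.log 2 := by linarith [Real.log_two_gt_d9]
  have hi65 : i - 65 ≤ 2 * (5 * Λ) := by
    by_contra! hlt
    nlinarith
  linarith

lemma rpow_three_halves_two_pow_mul_pow_four {x : ℝ} (hx : 0 ≤ x) :
    (2 ^ 64 * x ^ 4) ^ (3 / 2 : ℝ) = 2 ^ 54 * (2 ^ 7 * x) ^ 6 := by
  rw [Real.mul_rpow (by positivity) (by positivity), ← Real.rpow_natCast_mul (by positivity),
    ← Real.rpow_natCast_mul (by positivity), mul_pow, ← Real.rpow_natCast, ← Real.rpow_natCast]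
  norm_num
  ring

lemma exists_resolves {a c : ℕ} (hc : 1 ≤ c) (hca : c ≤ a) (hε : 0 < ε) (hε1 : ε ≤ 1) :
    ∃ I : ℕ, Resolves a c I (ε / (I + 1) ^ 2) ∧
      3 * (2 : ℝ) ^ I ≤ 2 ^ 67 * Real.log (2 + a * c / ε) ^ 4 * rate a c ε := by
  have hcR : (1 : ℝ) ≤ c := by exact_mod_cast hc
  have hcaR : (c : ℝ) ≤ a := by exact_mod_cast hca
  have haR : (1 : ℝ) ≤ a := hcR.trans hcaR
  have hac : 1 ≤ a * c / ε :=
    (one_le_mul_of_one_le_of_one_le haR hcR).trans (le_div_self (by positivity) hε hε1)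
  have hΛ := one_le_log_two_add hac
  set Λ := Real.log (2 + a * c / ε)
  have hcr := le_rate (by linarith) hcaR hε hε1
  have hB : 1 ≤ 2 ^ 64 * Λ ^ 4 := by linarith [one_le_pow₀ hΛ (n := 4)]
  obtain ⟨i, hle, hlt⟩ := exists_nat_pow_near
    (one_le_mul_of_one_le_of_one_le hB (hcR.trans hcr)) (by norm_num : (1 : ℝ) < 2)
  have hup : (2 : ℝ) ^ (i + 1) ≤ 2 ^ 65 * Λ ^ 4 * rate a c ε := by
    rw [pow_succ]
    linarith
  have hI : ((i + 1 : ℕ) : ℝ) + 1 ≤ 2 ^ 7 * Λ :=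
    add_one_le_two_pow_seven_mul_log hac (hup.trans (by gcongr; exact rate_le haR hcR hε.le))
  refine ⟨i + 1, ⟨by positivity, ?_, ?_⟩, ?_⟩
  · have : (c : ℝ) ≤ 2 ^ (i + 1) :=
      hcr.trans ((le_mul_of_one_le_left (by linarith) hB).trans hlt.le)
    exact_mod_cast this
  · have hsize := rpow_three_halves_mul_le_sq (n := 2 ^ (i + 1)) (by positivity) (by linarith)
      (by linarith) hε hB hlt.le
    rw [rpow_three_halves_two_pow_mul_pow_four (by linarith)] at hsize
    rw [mul_div_assoc', div_pow, le_div_iff₀ (by positivity)]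
    refine le_trans ?_ hsize
    calc _ = 2 ^ 50 * (((i + 1 : ℕ) : ℝ) + 1) ^ 6 * (a * √c * √(min (2 ^ (i + 1)) (a : ℝ))) := by
          ring
      _ ≤ _ := by
          gcongr <;> norm_num
  · linarith [mul_nonneg (pow_nonneg (by linarith : 0 ≤ Λ) 4) (by linarith : 0 ≤ rate a c ε)]

end SampleSize

section DiscreteLaws

lemma toMeasure_real_singleton {Ω : Type*} [MeasurableSpace Ω] [MeasurableSingletonClass Ω]
    (P : PMF Ω) (x : Ω) : P.toMeasure.real {x} = (P x).toReal := by
  rw [measureReal_def, P.toMeasure_apply_singleton x (measurableSet_singleton x)]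

lemma sum_toReal_eq_one {Ω : Type*} [Fintype Ω] (P : PMF Ω) : ∑ x, (P x).toReal = 1 := by
  rw [← ENNReal.toReal_sum fun x _ => P.apply_ne_top x, ← tsum_fintype (L := .unconditional Ω),
    P.tsum_coe, ENNReal.toReal_one]

lemma hellingerSq_le_one {Ω : Type} [Fintype Ω] (P Q : PMF Ω) : hellingerSq P Q ≤ 1 := by
  have hterm (x : Ω) : (√(P x).toReal - √(Q x).toReal) ^ 2 ≤ (P x).toReal + (Q x).toReal := by
    nlinarith [Real.sq_sqrt (P x).toReal_nonneg, Real.sq_sqrt (Q x).toReal_nonneg,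
      mul_nonneg ((P x).toReal.sqrt_nonneg) ((Q x).toReal.sqrt_nonneg)]
  have hsum := Finset.sum_le_sum fun x (_ : x ∈ Finset.univ) => hterm x
  rw [Finset.sum_add_distrib, sum_toReal_eq_one, sum_toReal_eq_one] at hsum
  unfold hellingerSq
  linarith

end DiscreteLaws

section Testers

lemma two_thirds_le_of_measureReal_compl_le {S : Type*} [MeasurableSpace S] {σ : Measure S}
    [IsProbabilityMeasure σ] {s : Set S} (hs : MeasurableSet s) (h : σ.real sᶜ ≤ 1 / 3) :
    2 / 3 ≤ σ s := by
  rw [probReal_compl_eq_one_sub hs] at h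
  rw [← ofReal_measureReal, show (2 / 3 : ℝ≥0∞) = ENNReal.ofReal (2 / 3) by
    rw [ENNReal.ofReal_div_of_pos (by norm_num)]; simp]
  exact ENNReal.ofReal_le_ofReal (by linarith)

lemma measurePreserving_unzip_pi {X Y : Type*} [MeasurableSpace X] [MeasurableSpace Y]
    (μ : Measure X) (ν : Measure Y) [SigmaFinite μ] [SigmaFinite ν] (n : ℕ) :
    MeasurePreserving (fun s : Fin n → X × Y => (fun m => (s m).1, fun m => (s m).2))
      (Measure.pi fun _ => μ.prod ν) ((Measure.pi fun _ => μ).prod (Measure.pi fun _ => ν)) :=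
  measurePreserving_arrowProdEquivProdArrow X Y (Fin n) (fun _ => μ) fun _ => ν

lemma measurePreserving_split_pi {X : Type*} [MeasurableSpace X] (μ : Measure X) [SigmaFinite μ]
    (m n : ℕ) :
    MeasurePreserving
      (fun s : Fin (m + n) → X => (fun i => s (Fin.castAdd n i), fun i => s (Fin.natAdd m i)))
      (Measure.pi fun _ => μ) ((Measure.pi fun _ => μ).prod (Measure.pi fun _ => μ)) :=
  (measurePreserving_sumPiEquivProdPi fun _ : Fin m ⊕ Fin n => μ).comp
    (measurePreserving_piCongrLeft (fun _ : Fin (m + n) => μ) finSumFinEquiv).symm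

variable {A C : Type}

/-- The test data extracted from two samples: the first block of the second sample provides the
auxiliary samples, and the other two blocks are paired. -/
def testData (I : ℕ) (s : (Fin (2 ^ I + (2 ^ I + 2 ^ I)) → A × C) ×
    (Fin (2 ^ I + (2 ^ I + 2 ^ I)) → A × C)) : TestData A C I :=
  ((fun m => (s.2 (Fin.castAdd _ m)).1, fun m => (s.2 (Fin.castAdd _ m)).2),
    (fun m => (s.1 (Fin.natAdd _ (Fin.castAdd _ m)), s.2 (Fin.natAdd _ (Fin.castAdd _ m))),
      fun m => (s.1 (Fin.natAdd _ (Fin.natAdd _ m)), s.2 (Fin.natAdd _ (Fin.natAdd _ m)))))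

variable [MeasurableSpace A] [MeasurableSpace C]

lemma measurePreserving_testData (P : Measure (A × C)) (QA : Measure A) (QC : Measure C)
    [IsProbabilityMeasure P] [IsProbabilityMeasure QA] [IsProbabilityMeasure QC] (I : ℕ) :
    MeasurePreserving (testData I)
      ((Measure.pi fun _ => P).prod (Measure.pi fun _ => QA.prod QC)) (testLaw P QA QC I) := by
  set N := 2 ^ I + (2 ^ I + 2 ^ I)
  set L := P.prod (QA.prod QC)
  have hzip : MeasurePreserving
      (fun s : (Fin N → A × C) × (Fin N → A × C) => fun m => (s.1 m, s.2 m))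
      ((Measure.pi fun _ => P).prod (Measure.pi fun _ => QA.prod QC)) (Measure.pi fun _ => L) :=
    (measurePreserving_arrowProdEquivProdArrow (A × C) (A × C) (Fin N) (fun _ => P)
      fun _ => QA.prod QC).symm
  have haux := (measurePreserving_unzip_pi QA QC (2 ^ I)).comp
    (measurePreserving_pi (fun _ : Fin (2 ^ I) => L) (fun _ => QA.prod QC)
      fun _ => measurePreserving_snd)
  exact (haux.prod (measurePreserving_split_pi L (2 ^ I) (2 ^ I))).comp
    ((measurePreserving_split_pi L (2 ^ I) (2 ^ I + 2 ^ I)).comp hzip)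

lemma exists_succeeds_of_one_lt [Fintype A] [Fintype C] {ε : ℝ} (hε : 1 < ε) :
    ∃ T : Tester (A × C) 0, Succeeds hellingerSq ε T := by
  refine ⟨fun _ _ => PMF.pure true, fun P Q _ => ⟨fun _ => ?_, fun h => ?_⟩⟩
  · have : IsProbabilityMeasure (iidLaw P 0) := by unfold iidLaw; infer_instance
    have : IsProbabilityMeasure (iidLaw Q 0) := by unfold iidLaw; infer_instance
    simp only [outputProb, PMF.pure_apply, if_true, lintegral_const, measure_univ, mul_one]
    exact ENNReal.div_le_of_le_mul (by norm_num)
  · linarith [hellingerSq_le_one P Q]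

variable [MeasurableSingletonClass A] [MeasurableSingletonClass C]

lemma IsProduct.exists_toMeasure_eq_prod [Finite A] [Finite C] {Q : PMF (A × C)}
    (hQ : IsProduct Q) :
    ∃ (QA : PMF A) (QC : PMF C), Q.toMeasure = QA.toMeasure.prod QC.toMeasure := by
  obtain ⟨QA, QC, hprod⟩ := hQ
  refine ⟨QA, QC, Measure.ext_iff_singleton.2 fun x => ?_⟩
  rw [← Prod.mk.eta (p := x), ← Set.singleton_prod_singleton, Measure.prod_prod,
    Set.singleton_prod_singleton]
  simp only [PMF.toMeasure_apply_singleton _ _ (measurableSet_singleton _), hprod]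

variable {I : ℕ}

open Classical in
/-- The deterministic tester that answers "No" exactly when the test data lies in `R`. -/
def rejectingTester (R : Set (TestData A C I)) : Tester (A × C) (2 ^ I + (2 ^ I + 2 ^ I)) :=
  fun s t => PMF.pure (decide (testData I (s, t) ∉ R))

lemma outputProb_rejectingTester [Finite A] [Finite C] (P Q : PMF (A × C)) {QA : PMF A}
    {QC : PMF C} (hQ : Q.toMeasure = QA.toMeasure.prod QC.toMeasure) (R : Set (TestData A C I))
    (b : Bool) :
    outputProb (rejectingTester R) P Q b =
      testLaw P.toMeasure QA.toMeasure QC.toMeasure I (bif b then Rᶜ else R) := by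
  have hind (s : (Fin (2 ^ I + (2 ^ I + 2 ^ I)) → A × C) ×
      (Fin (2 ^ I + (2 ^ I + 2 ^ I)) → A × C)) : rejectingTester R s.1 s.2 b =
        (bif b then Rᶜ else R).indicator 1 (testData I s) := by
    cases b <;> by_cases hs : testData I s ∈ R <;> simp [rejectingTester, hs]
  rw [outputProb, iidLaw, iidLaw, hQ, lintegral_congr hind,
    (measurePreserving_testData _ _ _ I).lintegral_comp .of_discrete,
    lintegral_indicator_one .of_discrete]

lemma succeeds_rejectingTester [Fintype A] [Fintype C] [DecidableEq A] [DecidableEq C] {ε : ℝ}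
    (hCA : Fintype.card C ≤ Fintype.card A)
    (hε : Resolves (Fintype.card A) (Fintype.card C) I (ε / (I + 1) ^ 2)) :
    Succeeds hellingerSq ε (rejectingTester (rejection A C I)) := by
  intro P Q hQ
  obtain ⟨QA, QC, hprod⟩ := hQ.exists_toMeasure_eq_prod
  refine ⟨fun hPQ => ?_, fun hfar => ?_⟩ <;> rw [outputProb_rejectingTester P Q hprod] <;>
    refine two_thirds_le_of_measureReal_compl_le .of_discrete ?_
  · rw [hPQ, hprod, cond_true, compl_compl]
    exact (testLaw_rejection_le _ _ I).trans (by norm_num)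
  · refine (testLaw_compl_rejection_le _ _ _ hCA hε ?_).trans (by norm_num)
    rw [← hprod, mul_left_comm, mul_div_cancel₀ _ (by positivity)]
    simp only [toMeasure_real_singleton]
    unfold hellingerSq at hfar
    linarith

end Testers

section SampleComplexity

variable {A C : Type} [MeasurableSpace A] [MeasurableSpace C]

lemma sampleComplexity_le {Δ : PMF (A × C) → PMF (A × C) → ℝ} {ε : ℝ} {N : ℕ}
    {T : Tester (A × C) N} (hT : Succeeds Δ ε T) {x : ℝ} (hx : N ≤ x) :
    ((sampleComplexity Δ ε : ℕ∞) : ℝ≥0∞) ≤ ENNReal.ofReal x :=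
  calc ((sampleComplexity Δ ε : ℕ∞) : ℝ≥0∞) ≤ ((N : ℕ∞) : ℝ≥0∞) :=
        ENat.toENNReal_le.2 (iInf₂_le N ⟨T, hT⟩)
    _ = ENNReal.ofReal N := by rw [ENat.toENNReal_coe, ENNReal.ofReal_natCast]
    _ ≤ ENNReal.ofReal x := ENNReal.ofReal_le_ofReal hx

end SampleComplexity

end EqProd

end

theorem mainTheorem5_general {A C : Type} [MeasurableSpace A] [MeasurableSpace C] [Fintype A]
    [Fintype C] [MeasurableSingletonClass A] [MeasurableSingletonClass C] [Nonempty C]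
    (hCA : Fintype.card C ≤ Fintype.card A) {ε : ℝ} (hε : 0 < ε) :
    ((EqProd.sampleComplexity (A := A) (C := C) EqProd.hellingerSq ε : ℕ∞) : ℝ≥0∞) ≤
      ENNReal.ofReal (2 ^ 67 * Real.log (2 + Fintype.card A * Fintype.card C / ε) ^ 4 *
        EqProd.rate (Fintype.card A) (Fintype.card C) ε) := by
  classical
  rcases lt_or_ge 1 ε with h1 | h1
  · obtain ⟨T, hT⟩ := EqProd.exists_succeeds_of_one_lt (A := A) (C := C) h1
    refine EqProd.sampleComplexity_le hT ?_
    rw [Nat.cast_zero]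
    exact mul_nonneg (by positivity) (EqProd.rate_nonneg (by positivity) (by positivity) hε.le)
  · obtain ⟨I, hres, hI⟩ := EqProd.exists_resolves Fintype.card_pos hCA hε h1
    refine EqProd.sampleComplexity_le (EqProd.succeeds_rejectingTester hCA hres) ?_
    push_cast
    linarith

theorem mainTheorem5 :
    ∃ (K : ℝ) (k : ℕ), 0 < K ∧
      ∀ (dA dC : ℕ) (ε : ℝ), 1 ≤ dC → dC ≤ dA → 0 < ε →
        ((EqProd.sampleComplexity (A := Fin dA) (C := Fin dC) EqProd.hellingerSq ε : ℕ∞) : ℝ≥0∞) ≤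
          ENNReal.ofReal
            (K * Real.log (2 + (dA : ℝ) * (dC : ℝ) / ε) ^ k *
              min ((dA : ℝ) ^ (3 / 4 : ℝ) * (dC : ℝ) ^ (1 / 4 : ℝ) / ε)
                ((dA : ℝ) ^ (2 / 3 : ℝ) * (dC : ℝ) ^ (1 / 3 : ℝ) / ε ^ (4 / 3 : ℝ))) := by
  refine ⟨2 ^ 67, 4, by positivity, fun dA dC ε hC hCA hε => ?_⟩
  have : Nonempty (Fin dC) := ⟨⟨0, hC⟩⟩
  simpa only [Fintype.card_fin, EqProd.rate] using
    mainTheorem5_general (A := Fin dA) (C := Fin dC) (by simpa only [Fintype.card_fin] using hCA) hε
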